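/- Let $\alpha,\beta,v$ be real numbers with $|\alpha-\beta|<|v|<\alpha+\beta+2$ (so $\alpha,\beta>-1$ and $v\neq 0$). On $(-1,1)$ consider the $2\times 2$ weight matrices \[ W(x)=(1-x)^{\alpha}(1+x)^{\beta}\Big(W_2\tfrac{(1-x)^2}{4}+W_1\tfrac{1-x}{2}+W_0\Big),\qquad \widetilde W(x)=(1-x)^{\alpha+1}(1+x)^{\beta+1}I, \] \[ W_2=\begin{pmatrix}\frac{v(v+2+\alpha+\beta)}{v+\alpha-\beta}&0\\0&\frac{v(-v+2+\alpha+\beta)}{v-\alpha+\beta}\end{pmatrix},\quad W_1=\begin{pmatrix}-(v+\alpha+\beta+2)&\alpha+\beta+2\\ \alpha+\beta+2&-(-v+\alpha+\beta+2)\end{pmatrix},\quad W_0=\begin{pmatrix}\alpha+1&-\alpha-1\\-\alpha-1&\alpha+1\end{pmatrix}. \] Differential operators $D=\sum_i\partial^iF_i(x)$ with coefficients $F_i\in\mathrm{Mat}_2(\mathbb C[x])$ act on the right on matrix polynomials, $P\cdot D=\sum_i P^{(i)}F_i$, and are multiplied so that $P\cdot(DE)=(P\cdot D)\cdot E$. For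 a weight matrix $U$ on $(-1,1)$ with orthogonal polynomials $Q_n$ (of degree $n$ with nonsingular leading coefficient, and $\int_{-1}^{1} Q_nUQ_m^*\,dx=0$ for $n\ne m$), let $\mathcal D(U)$ be the algebra of all such operators $D$ for which, for every $n\ge 0$, there is a constant matrix $\Lambda_n(D)$ with $Q_n\cdot D=\Lambda_n(D)Q_n$ (this does not depend on the choice of the sequence $Q_n$), and let $\mathcal Z(U)$ be the center of $\mathcal D(U)$. Put \[ \delta=\delta_{\alpha+1,\beta+1}=\partial^2(1-x^2)+\partial\big(\beta-\alpha-x(\alpha+\beta+4)\big), \] \[ \mathcal V=\partial\begin{pmatrix}x+\frac{\beta-\alpha}{v}&1+\frac{\beta-\alpha}{v}\\1+\frac{\alpha-\beta}{v}&x+\frac{\alpha-\beta}{v}\end{pmatrix}+\begin{pmatrix}\frac{v+2+\alpha+\beta}{2}&0\\0&\frac{-v+2+\alpha+\beta}{2}\end{pmatrix}, \] \[ \mathcal N=\partial\begin{pmatrix}-x+\frac{\beta-\alpha}{v}&1+\frac{\beta-\alpha}{v}\\1+\frac{\alpha-\beta}{v}&-x+\frac{\alpha-\beta}{v}\end{pmatrix}-\begin{pmatrix}\frac{-v+4+\alpha+\beta}{2}&0\\0&\frac{\alpha+\beta+v+4}{2}\end{pmatrix},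 \] \[ \mathcal A=\begin{pmatrix}\delta-\frac14(\alpha+\beta+v+4)(-v+2+\alpha+\beta)&0\\0&\delta-\frac14(-v+4+\alpha+\beta)(v+2+\alpha+\beta)\end{pmatrix}, \] $D_1=\mathcal N\begin{pmatrix}1&0\\0&0\end{pmatrix}\mathcal V$, $D_4=\mathcal N\begin{pmatrix}0&0\\0&1\end{pmatrix}\mathcal V$, $Z_1=\mathcal N\mathcal A\mathcal V$ and $Z_2=\mathcal N\,\delta\,\mathcal A\mathcal V$ (where $\delta$ stands for $\delta I$). **Theorem.** The operators $Z_1$ and $Z_2$ have orders four and six, and \[ Z_1=D_1^2+D_4^2+v(D_1-D_4), \] \[ Z_2=D_1^3+D_4^3+\tfrac14(-v+4+\alpha+\beta)(v+2+\alpha+\beta)(D_1^2+vD_1)+\tfrac14(-v+2+\alpha+\beta)(v+4+\alpha+\beta)(D_4^2-vD_4)+v(D_1^2-D_4^2). \] The center $\mathcal Z(W)$ of $\mathcal D(W)$ is the unital $\mathbb C$-algebra generated by $\{I,Z_1,Z_2\}$. Moreover \[ \mathcal Z(W)=\mathbb C I\oplus\mathcal N\,\mathcal Z(\widetilde W)\,\mathcal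 A\mathcal V . \] -/

import Mathlib

open Polynomial

noncomputable section

namespace MatOP

/-- Matrix polynomials `Mat_N(ℂ[x])`. -/
abbrev MatPoly (N : ℕ) : Type := Matrix (Fin N) (Fin N) ℂ[X]

/-- The algebra in which right-acting operators on `Mat_N(ℂ[x])` live: the ring opposite to
`End_ℂ(Mat_N(ℂ[x]))`, so that `P · (D E) = (P · D) · E`. -/
abbrev RightOp (N : ℕ) : Type := (Module.End ℂ (MatPoly N))ᵐᵒᵖ

/-- The right action `P · D`. -/
def act {N : ℕ} (P : MatPoly N) (D : RightOp N) : MatPoly N := D.unop P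

/-- Entrywise derivative of a matrix polynomial. -/
def derivEnd (N : ℕ) : Module.End ℂ (MatPoly N) where
  toFun P := P.map Polynomial.derivative
  map_add' P Q := by ext1 i j; simp
  map_smul' c P := by ext1 i j; simp

/-- The operator `∂`, i.e. `P · ∂ = P'`. -/
def del (N : ℕ) : RightOp N := MulOpposite.op (derivEnd N)

/-- The operator of order zero `P ↦ P F`. -/
def coef {N : ℕ} (F : MatPoly N) : RightOp N := MulOpposite.op (LinearMap.mulRight ℂ F)

/-- The differential operator `∑_{i=0}^m ∂^i F_i`, i.e. `P ↦ ∑_{i=0}^m P^{(i)} F_i`. -/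
def diffOp {N : ℕ} (m : ℕ) (F : ℕ → MatPoly N) : RightOp N :=
  ∑ i ∈ Finset.range (m + 1), del N ^ i * coef (F i)

/-- `D` is a matrix differential operator with polynomial coefficients. -/
def IsDiffOp {N : ℕ} (D : RightOp N) : Prop :=
  ∃ (m : ℕ) (F : ℕ → MatPoly N), D = diffOp m F

/-- `D` is a differential operator of order exactly `m`. -/
def HasOrder {N : ℕ} (D : RightOp N) (m : ℕ) : Prop :=
  ∃ F : ℕ → MatPoly N, F m ≠ 0 ∧ D = diffOp m F

lemma coef_zero {N : ℕ} : coef (0 : MatPoly N) = 0 := by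
  simp [coef]

lemma coef_add {N : ℕ} (F G : MatPoly N) : coef (F + G) = coef F + coef G := by
  apply MulOpposite.unop_injective
  ext1 P
  simp [coef, mul_add]

lemma coef_mul {N : ℕ} (F G : MatPoly N) : coef (F * G) = coef F * coef G := by
  apply MulOpposite.unop_injective
  ext1 P
  simp [coef, mul_assoc]

lemma coef_mul_del {N : ℕ} (F : MatPoly N) :
    coef F * del N = del N * coef F + coef (derivEnd N F) := by
  apply MulOpposite.unop_injective
  ext P i j
  simp [coef, del, derivEnd, Matrix.mul_apply, Finset.sum_add_distrib]

lemma isDiffOp_monomial {N : ℕ} (k : ℕ) (F : MatPoly N) : IsDiffOp (del N ^ k * coef F) := by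
  refine ⟨k, fun i => if i = k then F else 0, ?_⟩
  unfold diffOp
  rw [Finset.sum_eq_single k]
  · simp
  · intro i _ hi
    simp [hi, coef_zero]
  · intro h
    simp at h

lemma diffOp_extend {N : ℕ} (m n : ℕ) (F : ℕ → MatPoly N) (h : m ≤ n) :
    diffOp m F = diffOp n (fun i => if i ≤ m then F i else 0) := by
  unfold diffOp
  symm
  rw [← Finset.sum_subset (Finset.range_mono (Nat.succ_le_succ h))]
  · apply Finset.sum_congr rfl
    intro i hi
    have : i ≤ m := Nat.lt_succ_iff.mp (Finset.mem_range.mp hi)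
    simp [this]
  · intro i _ hi
    have : ¬ i ≤ m := fun h => hi (Finset.mem_range.mpr (Nat.lt_succ_of_le h))
    simp [this, coef_zero]

lemma IsDiffOp.add {N : ℕ} {D E : RightOp N} (hD : IsDiffOp D) (hE : IsDiffOp E) :
    IsDiffOp (D + E) := by
  obtain ⟨m, F, rfl⟩ := hD
  obtain ⟨n, G, rfl⟩ := hE
  rw [diffOp_extend m (max m n) F (le_max_left _ _), diffOp_extend n (max m n) G (le_max_right _ _)]
  exact ⟨max m n, fun i => (if i ≤ m then F i else 0) + (if i ≤ n then G i else 0), by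
    simp only [diffOp, coef_add, mul_add, Finset.sum_add_distrib]⟩

lemma IsDiffOp.zero {N : ℕ} : IsDiffOp (0 : RightOp N) :=
  ⟨0, fun _ => 0, by simp [diffOp, coef_zero]⟩

lemma IsDiffOp.sum {N : ℕ} {ι : Type*} (s : Finset ι) (D : ι → RightOp N)
    (h : ∀ i ∈ s, IsDiffOp (D i)) : IsDiffOp (∑ i ∈ s, D i) :=
  Finset.sum_induction D IsDiffOp (fun _ _ => IsDiffOp.add) IsDiffOp.zero h

lemma IsDiffOp.mul_coef {N : ℕ} {D : RightOp N} (hD : IsDiffOp D) (G : MatPoly N) :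
    IsDiffOp (D * coef G) := by
  obtain ⟨m, F, rfl⟩ := hD
  exact ⟨m, fun i => F i * G, by simp only [diffOp, coef_mul, Finset.sum_mul, mul_assoc]⟩

lemma IsDiffOp.mul_del {N : ℕ} {D : RightOp N} (hD : IsDiffOp D) : IsDiffOp (D * del N) := by
  obtain ⟨m, F, rfl⟩ := hD
  unfold diffOp
  rw [Finset.sum_mul]
  apply IsDiffOp.sum
  intro i _
  rw [mul_assoc, coef_mul_del, mul_add, ← mul_assoc, ← pow_succ]
  exact (isDiffOp_monomial _ _).add (isDiffOp_monomial _ _)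

lemma IsDiffOp.mul_del_pow {N : ℕ} {D : RightOp N} (hD : IsDiffOp D) (k : ℕ) :
    IsDiffOp (D * del N ^ k) := by
  induction k with
  | zero => simpa using hD
  | succ k ih =>
    rw [pow_succ, ← mul_assoc]
    exact ih.mul_del

lemma IsDiffOp.mul {N : ℕ} {D E : RightOp N} (hD : IsDiffOp D) (hE : IsDiffOp E) :
    IsDiffOp (D * E) := by
  obtain ⟨n, G, rfl⟩ := hE
  unfold diffOp
  rw [Finset.mul_sum]
  apply IsDiffOp.sum
  intro i _
  rw [← mul_assoc]
  exact (hD.mul_del_pow i).mul_coef (G i)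

lemma isDiffOp_algebraMap {N : ℕ} (c : ℂ) : IsDiffOp (algebraMap ℂ (RightOp N) c) := by
  refine ⟨0, fun _ => c • (1 : MatPoly N), ?_⟩
  apply MulOpposite.unop_injective
  ext1 P
  simp [diffOp, coef, Algebra.algebraMap_eq_smul_one]

/-- The algebra `Mat_N(Ω[x])` of matrix differential operators with polynomial coefficients. -/
def diffOpAlgebra (N : ℕ) : Subalgebra ℂ (RightOp N) where
  carrier := {D | IsDiffOp D}
  mul_mem' := IsDiffOp.mul
  add_mem' := IsDiffOp.add
  algebraMap_mem' := isDiffOp_algebraMap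

/-- Value of a matrix polynomial at a real point. -/
def evalAt {N : ℕ} (P : MatPoly N) (x : ℝ) : Matrix (Fin N) (Fin N) ℂ :=
  P.map (Polynomial.eval (x : ℂ))

/-- The matrix-valued form `⟨P, Q⟩_W = ∫_I P(x) W(x) Q(x)^* dx` (entrywise integral). -/
def form {N : ℕ} (I : Set ℝ) (W : ℝ → Matrix (Fin N) (Fin N) ℂ) (P Q : MatPoly N) :
    Matrix (Fin N) (Fin N) ℂ :=
  Matrix.of fun i j => ∫ x in I, (evalAt P x * W x * (evalAt Q x).conjTranspose) i j

/-- `P` has degree `n` with nonsingular leading coefficient. -/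
def IsRegularOfDegree {N : ℕ} (P : MatPoly N) (n : ℕ) : Prop :=
  (∀ i j, (P i j).natDegree ≤ n) ∧ IsUnit (P.map fun p => p.coeff n)

/-- `Q_0, Q_1, …` is a sequence of matrix orthogonal polynomials for the weight `W` on `I`. -/
def IsOrthogonalSeq {N : ℕ} (I : Set ℝ) (W : ℝ → Matrix (Fin N) (Fin N) ℂ)
    (Q : ℕ → MatPoly N) : Prop :=
  (∀ n, IsRegularOfDegree (Q n) n) ∧ ∀ n m, n ≠ m → form I W (Q n) (Q m) = 0

/-- `P · D = Λ P` for some constant matrix `Λ`. -/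
def IsEigen {N : ℕ} (P : MatPoly N) (D : RightOp N) : Prop :=
  ∃ L : Matrix (Fin N) (Fin N) ℂ, act P D = L.map Polynomial.C * P

lemma IsEigen.mul {N : ℕ} {P : MatPoly N} {D E : RightOp N} (hD : IsEigen P D)
    (hE : IsEigen P E) (h : IsDiffOp E) : IsEigen P (D * E) := by
  obtain ⟨L, hL⟩ := hD
  obtain ⟨K, hK⟩ := hE
  refine ⟨L * K, ?_⟩
  have key : ∀ (R : MatPoly N), act (L.map Polynomial.C * R) E = L.map Polynomial.C * act R E := by
    obtain ⟨m, F, rfl⟩ := h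
    have hd : ∀ (k : ℕ) (R : MatPoly N), ((derivEnd N) ^ k) (L.map Polynomial.C * R)
        = L.map Polynomial.C * ((derivEnd N) ^ k) R := by
      intro k
      induction k with
      | zero => intro R; simp
      | succ k ih =>
        intro R
        rw [pow_succ, Module.End.mul_apply, Module.End.mul_apply, ← ih]
        congr 1
        ext1 i j
        simp [derivEnd, Matrix.mul_apply]
    intro R
    simp [act, diffOp, del, coef, hd, mul_assoc, Finset.mul_sum]
  have : act P (D * E) = act (act P D) E := rfl
  rw [this, hL, key, hK, ← mul_assoc, Matrix.map_mul]

/-- The algebra `𝒟(W)`: the matrix differential operators with polynomial coefficients having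
every orthogonal polynomial `Q_n` as an eigenfunction, `Q_n · D = Λ_n(D) Q_n`.  The condition does
not depend on the choice of the sequence of orthogonal polynomials. -/
def algD {N : ℕ} (I : Set ℝ) (W : ℝ → Matrix (Fin N) (Fin N) ℂ) : Subalgebra ℂ (RightOp N) where
  carrier := {D | IsDiffOp D ∧ ∀ Q, IsOrthogonalSeq I W Q → ∀ n, IsEigen (Q n) D}
  mul_mem' := fun ha hb =>
    ⟨ha.1.mul hb.1, fun Q hQ n => (ha.2 Q hQ n).mul (hb.2 Q hQ n) hb.1⟩
  add_mem' := fun ha hb => ⟨ha.1.add hb.1, fun Q hQ n => by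
    obtain ⟨L, hL⟩ := ha.2 Q hQ n
    obtain ⟨K, hK⟩ := hb.2 Q hQ n
    refine ⟨L + K, ?_⟩
    rw [Matrix.map_add _ (fun _ _ => Polynomial.C_add), add_mul, ← hL, ← hK]
    rfl⟩
  algebraMap_mem' := fun c => ⟨isDiffOp_algebraMap c, fun Q _ n => by
    refine ⟨c • (1 : Matrix (Fin N) (Fin N) ℂ), ?_⟩
    have h1 : ((c • (1 : Matrix (Fin N) (Fin N) ℂ)).map Polynomial.C)
        = c • (1 : MatPoly N) := by
      ext1 i j
      by_cases h : i = j
      · subst h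
        simp [Polynomial.smul_eq_C_mul]
      · simp [h]
    rw [h1]
    simp [act, Algebra.algebraMap_eq_smul_one]⟩

/-- The center `𝒵(W)` of `𝒟(W)`, as a subalgebra of the algebra of all right-acting operators. -/
def centerD {N : ℕ} (I : Set ℝ) (W : ℝ → Matrix (Fin N) (Fin N) ℂ) : Subalgebra ℂ (RightOp N) :=
  (Subalgebra.center ℂ (algD I W)).map (algD I W).val

/-- Real scalars as constant complex polynomials. -/
def rC (r : ℝ) : ℂ[X] := Polynomial.C (r : ℂ)

/-- The Jacobi-type `2 × 2` weight
`W(x) = (1-x)^α (1+x)^β (W₂ (1-x)²/4 + W₁ (1-x)/2 + W₀)`. -/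
def jacobiW (α β v : ℝ) (x : ℝ) : Matrix (Fin 2) (Fin 2) ℂ :=
  let W₂ : Matrix (Fin 2) (Fin 2) ℝ :=
    !![v * (v + 2 + α + β) / (v + α - β), 0;
       0, v * (-v + 2 + α + β) / (v - α + β)]
  let W₁ : Matrix (Fin 2) (Fin 2) ℝ :=
    !![-(v + α + β + 2), α + β + 2;
       α + β + 2, -(-v + α + β + 2)]
  let W₀ : Matrix (Fin 2) (Fin 2) ℝ :=
    !![α + 1, -α - 1;
       -α - 1, α + 1]
  (((1 - x) ^ α * (1 + x) ^ β) •
    (((1 - x) ^ 2 / 4) • W₂ + ((1 - x) / 2) • W₁ + W₀)).map fun r : ℝ => (r : ℂ)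

/-- The diagonal weight `W̃(x) = (1-x)^{α+1} (1+x)^{β+1} I`. -/
def jacobiWt (α β : ℝ) (x : ℝ) : Matrix (Fin 2) (Fin 2) ℂ :=
  (((1 - x) ^ (α + 1) * (1 + x) ^ (β + 1) : ℝ) : ℂ) • (1 : Matrix (Fin 2) (Fin 2) ℂ)

/-- The scalar Jacobi operator `δ_{a,b} = ∂² (1-x²) + ∂ (b - a - x (a+b+2))`, times the identity
matrix of size two. -/
def jacobiDelta (a b : ℝ) : RightOp 2 :=
  del 2 ^ 2 * coef ((1 - X ^ 2 : ℂ[X]) • (1 : MatPoly 2))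
    + del 2 * coef ((rC (b - a) - X * rC (a + b + 2)) • (1 : MatPoly 2))

/-- The first-order operator `𝒱`. -/
def opV (α β v : ℝ) : RightOp 2 :=
  del 2 * coef !![X + rC ((β - α) / v), rC (1 + (β - α) / v);
                  rC (1 + (α - β) / v), X + rC ((α - β) / v)]
    + coef !![rC ((v + 2 + α + β) / 2), 0;
              0, rC ((-v + 2 + α + β) / 2)]

/-- The first-order operator `𝒩`. -/
def opN (α β v : ℝ) : RightOp 2 :=
  del 2 * coef !![-X + rC ((β - α) / v), rC (1 + (β - α) / v);
                  rC (1 + (α - β) / v), -X + rC ((α - β) / v)]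
    + coef !![rC (-(1 / 2) * (-v + 4 + α + β)), 0;
              0, rC (-(1 / 2) * (α + β + v + 4))]

/-- The diagonal second-order operator `𝒜`. -/
def opA (α β v : ℝ) : RightOp 2 :=
  jacobiDelta (α + 1) (β + 1)
    - coef !![rC ((1 / 4) * (α + β + v + 4) * (-v + 2 + α + β)), 0;
              0, rC ((1 / 4) * (-v + 4 + α + β) * (v + 2 + α + β))]

/-- `D₁ = 𝒩 E₁₁ 𝒱`. -/
def opD1 (α β v : ℝ) : RightOp 2 := opN α β v * coef !![1, 0; 0, 0] * opV α β v

/-- `D₄ = 𝒩 E₂₂ 𝒱`. -/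
def opD4 (α β v : ℝ) : RightOp 2 := opN α β v * coef !![0, 0; 0, 1] * opV α β v

/-- `Z₁ = 𝒩 𝒜 𝒱`. -/
def opZ1 (α β v : ℝ) : RightOp 2 := opN α β v * opA α β v * opV α β v

/-- `Z₂ = 𝒩 δ_{α+1,β+1} 𝒜 𝒱`. -/
def opZ2 (α β v : ℝ) : RightOp 2 :=
  opN α β v * jacobiDelta (α + 1) (β + 1) * opA α β v * opV α β v

end MatOP

end

/-! The matrix problem is a Darboux transform of a scalar one. Let `R_n = p_n I` (`seqR`), with
`p_n` the Jacobi polynomials for the exponents `α+1, β+1` and `λ_n` their `δ`-eigenvalues, and set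
`Q_n = R_n · 𝒱` (`seqQ`). Up to a constant diagonal matrix, `𝒩` is the adjoint of `𝒱` between the
two weights (`form_opV`), and `𝒱𝒩 = δ - diag(c₂, c₁)` (`opV_mul_opN`). Hence the `Q_n` are
orthogonal for `W`, and an operator `T` with eigenvalue `Λ` on `R_n` gives `𝒩T𝒱` with eigenvalue
`diag(λ_n - c₂, λ_n - c₁) Λ` on `Q_n` (`hasEig_NTV`).

Since `λ_n ≤ 0 < c₁, c₂`, that diagonal matrix is invertible. Taking `T` constant realizes every
matrix as an eigenvalue at any prescribed degree, so the central operators are exactly those with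
scalar eigenvalues (`mem_centerD_iff`). Evaluation at `x = 1`, where derivatives of `p_n` are
polynomials in `λ_n`, shows that such scalars have the form `l(λ_n)` with `l` a polynomial
(`exists_poly_eigenvalue`).

The operator `𝒩 p(δ) 𝒜 𝒱` has the scalar eigenvalue `q(λ_n) p(λ_n)`, where `q(t) = (t - c₁)(t - c₂)`
is `quadA`. Subtracting a constant and such an operator from a central one leaves the eigenvalue `b
λ_n`. If `b ≠ 0`, some differential operator `D` satisfies `𝒱D = δ𝒱`, which comparison of
coefficients excludes (`opV_mul_ne_delta_mul_opV`). The center is therefore a copy of `ℂ + q ℂ[t]`.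
Division by `q` shows that `q` and `t q`, the eigenvalues of `Z₁` and `Z₂`, generate it; the sum is
direct because a multiple of `q` that is constant is zero. The formulas in `D₁` and `D₄` are
identities between eigenvalues, since an operator is determined by its action on the `Q_n`
(`IsDiffOp.ext_of_regular`). -/

noncomputable section

namespace MatOP

/-! ### Right action, uniqueness of coefficients, leading coefficients -/

section Action

variable {N : ℕ}

lemma act_mul (P : MatPoly N) (D E : RightOp N) : act P (D * E) = act (act P D) E := rfl

lemma act_add (P : MatPoly N) (D E : RightOp N) : act P (D + E) = act P D + act P E := rfl

lemma act_sub (P : MatPoly N) (D E : RightOp N) : act P (D - E) = act P D - act P E := rfl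

lemma act_smul (P : MatPoly N) (c : ℂ) (D : RightOp N) : act P (c • D) = c • act P D := rfl

lemma act_one (P : MatPoly N) : act P (1 : RightOp N) = P := rfl

lemma smul_act (c : ℂ) (P : MatPoly N) (D : RightOp N) : act (c • P) D = c • act P D :=
  map_smul D.unop c P

lemma sum_act {ι : Type*} (s : Finset ι) (P : ι → MatPoly N) (D : RightOp N) :
    act (∑ i ∈ s, P i) D = ∑ i ∈ s, act (P i) D :=
  map_sum D.unop P s

lemma act_sum {ι : Type*} (s : Finset ι) (P : MatPoly N) (D : ι → RightOp N) :
    act P (∑ i ∈ s, D i) = ∑ i ∈ s, act P (D i) := by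
  classical
  induction s using Finset.induction_on with
  | empty => rfl
  | insert a s ha ih => rw [Finset.sum_insert ha, Finset.sum_insert ha, act_add, ih]

lemma act_coef (P F : MatPoly N) : act P (coef F) = P * F := rfl

lemma act_del (P : MatPoly N) : act P (del N) = derivEnd N P := rfl

lemma act_del_pow (P : MatPoly N) (k : ℕ) : act P (del N ^ k) = (derivEnd N ^ k) P := rfl

lemma ext_act {D E : RightOp N} (h : ∀ P, act P D = act P E) : D = E :=
  MulOpposite.unop_injective (LinearMap.ext h)

lemma derivEnd_smul_one (p : ℂ[X]) :
    derivEnd N (p • (1 : MatPoly N)) = derivative p • (1 : MatPoly N) := by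
  ext1 i j
  by_cases h : i = j <;> simp [derivEnd, h]

lemma derivEnd_pow_smul_one (k : ℕ) (p : ℂ[X]) :
    (derivEnd N ^ k) (p • (1 : MatPoly N)) = (derivative^[k] p) • (1 : MatPoly N) := by
  induction k with
  | zero => simp
  | succ k ih =>
    rw [pow_succ', Module.End.mul_apply, ih, derivEnd_smul_one, Function.iterate_succ_apply']

lemma act_diffOp (m : ℕ) (F : ℕ → MatPoly N) (P : MatPoly N) :
    act P (diffOp m F) = ∑ i ∈ Finset.range (m + 1), (derivEnd N ^ i) P * F i := by
  rw [diffOp, act_sum]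
  refine Finset.sum_congr rfl fun i _ => ?_
  rw [act_mul, act_del_pow, act_coef]

lemma act_smul_one_diffOp (m : ℕ) (F : ℕ → MatPoly N) (p : ℂ[X]) :
    act (p • (1 : MatPoly N)) (diffOp m F)
      = ∑ i ∈ Finset.range (m + 1), (derivative^[i] p) • F i := by
  rw [act_diffOp]
  refine Finset.sum_congr rfl fun i _ => ?_
  rw [derivEnd_pow_smul_one, smul_mul_assoc, one_mul]

lemma derivEnd_const_mul (L : Matrix (Fin N) (Fin N) ℂ) (R : MatPoly N) :
    derivEnd N (L.map C * R) = L.map C * derivEnd N R := by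
  ext1 i j
  simp [derivEnd, Matrix.mul_apply]

lemma act_const_mul {E : RightOp N} (hE : IsDiffOp E) (L : Matrix (Fin N) (Fin N) ℂ)
    (R : MatPoly N) : act (L.map C * R) E = L.map C * act R E := by
  obtain ⟨m, F, rfl⟩ := hE
  have hd : ∀ k : ℕ, (derivEnd N ^ k) (L.map C * R) = L.map C * (derivEnd N ^ k) R := by
    intro k
    induction k with
    | zero => simp
    | succ k ih =>
      rw [pow_succ', Module.End.mul_apply, Module.End.mul_apply, ih, derivEnd_const_mul]
  rw [act_diffOp, act_diffOp, Finset.mul_sum]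
  refine Finset.sum_congr rfl fun i _ => ?_
  rw [hd, mul_assoc]

/-- Test on `x^k I`: lower coefficients vanish by induction, higher derivatives kill `x^k`, and what
remains is `k! F_k`. -/
lemma diffOp_coeff_eq_zero {m : ℕ} {F : ℕ → MatPoly N} (h : diffOp m F = 0) :
    ∀ i ≤ m, F i = 0 := by
  intro i
  induction i using Nat.strong_induction_on with
  | _ k ih =>
    intro hk
    have h1 := act_smul_one_diffOp m F (X ^ k)
    rw [h, Finset.sum_eq_single k] at h1
    · rw [Polynomial.iterate_derivative_X_pow_eq_natCast_mul] at h1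
      simp only [Nat.descFactorial_self, Nat.sub_self, pow_zero, mul_one] at h1
      have h2 : act ((X ^ k : ℂ[X]) • (1 : MatPoly N)) (0 : RightOp N) = 0 := rfl
      rw [h2] at h1
      refine (smul_eq_zero.mp h1.symm).resolve_left ?_
      exact Nat.cast_ne_zero.mpr (Nat.factorial_ne_zero k)
    · intro i hi hik
      rcases lt_or_gt_of_ne hik with h' | h'
      · rw [ih i h' (by omega), smul_zero]
      · have h3 : (X ^ k : ℂ[X]).natDegree < i := by simpa using h'
        rw [Polynomial.iterate_derivative_eq_zero h3, zero_smul]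
    · intro h'
      simp at h'
      omega

lemma diffOp_sub (m : ℕ) (F G : ℕ → MatPoly N) :
    diffOp m F - diffOp m G = diffOp m (fun i => F i - G i) := by
  have : ∀ A B : MatPoly N, coef (A - B) = coef A - coef B := fun A B => by
    rw [eq_sub_iff_add_eq, ← coef_add, sub_add_cancel]
  simp only [diffOp, this, mul_sub, Finset.sum_sub_distrib]

lemma diffOp_injective {m : ℕ} {F G : ℕ → MatPoly N} (h : diffOp m F = diffOp m G) :
    ∀ i ≤ m, F i = G i := by
  intro i hi
  rw [← sub_eq_zero, diffOp_sub] at h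
  exact sub_eq_zero.mp (diffOp_coeff_eq_zero h i hi)

/-- `D` has order at most `m`, and the coefficient of `∂^m` is `f`. -/
def IsLead (D : RightOp N) (m : ℕ) (f : MatPoly N) : Prop :=
  ∃ F : ℕ → MatPoly N, F m = f ∧ D = diffOp m F

lemma IsLead.hasOrder {D : RightOp N} {m : ℕ} {f : MatPoly N} (h : IsLead D m f) (hf : f ≠ 0) :
    HasOrder D m := by
  obtain ⟨F, rfl, h⟩ := h
  exact ⟨F, hf, h⟩

lemma IsLead.add {D E : RightOp N} {m : ℕ} {f g : MatPoly N} (hD : IsLead D m f)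
    (hE : IsLead E m g) : IsLead (D + E) m (f + g) := by
  obtain ⟨F, rfl, rfl⟩ := hD
  obtain ⟨G, rfl, rfl⟩ := hE
  exact ⟨fun i => F i + G i, rfl, by
    simp only [diffOp, coef_add, mul_add, Finset.sum_add_distrib]⟩

/-- Padding by a zero top coefficient lets lower-order terms be added without affecting the leading
one. -/
lemma IsLead.succ {D : RightOp N} {m : ℕ} {f : MatPoly N} (hD : IsLead D m f) :
    IsLead D (m + 1) 0 := by
  obtain ⟨F, rfl, rfl⟩ := hD
  exact ⟨_, by simp, diffOp_extend m (m + 1) F (Nat.le_succ m)⟩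

lemma isLead_monomial (k : ℕ) (F : MatPoly N) : IsLead (del N ^ k * coef F) k F := by
  refine ⟨fun i => if i = k then F else 0, by simp, ?_⟩
  unfold diffOp
  rw [Finset.sum_eq_single k]
  · simp
  · intro i _ hi
    simp [hi, coef_zero]
  · intro h
    simp at h

lemma IsLead.mul_coef {D : RightOp N} {m : ℕ} {f : MatPoly N} (hD : IsLead D m f)
    (g : MatPoly N) : IsLead (D * coef g) m (f * g) := by
  obtain ⟨F, rfl, rfl⟩ := hD
  exact ⟨fun i => F i * g, rfl, by simp only [diffOp, coef_mul, Finset.sum_mul, mul_assoc]⟩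

lemma IsLead.mul_del {D : RightOp N} {m : ℕ} {f : MatPoly N} (hD : IsLead D m f) :
    IsLead (D * del N) (m + 1) f := by
  induction m generalizing D f with
  | zero =>
    obtain ⟨F, rfl, rfl⟩ := hD
    have h : diffOp 0 F * del N = del N ^ 1 * coef (F 0) + del N ^ 0 * coef (derivEnd N (F 0)) := by
      simp [diffOp, coef_mul_del]
    rw [h, ← add_zero (F 0)]
    simpa using (isLead_monomial 1 (F 0)).add (isLead_monomial 0 (derivEnd N (F 0))).succ
  | succ m ih =>
    obtain ⟨F, rfl, rfl⟩ := hD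
    have h : diffOp (m + 1) F * del N = del N ^ (m + 2) * coef (F (m + 1))
        + (del N ^ (m + 1) * coef (derivEnd N (F (m + 1))) + diffOp m F * del N) := by
      rw [diffOp, Finset.sum_range_succ, add_mul, mul_assoc, coef_mul_del, mul_add, ← mul_assoc,
        ← pow_succ, add_comm, add_assoc]
      rfl
    rw [h]
    have h2 := (isLead_monomial (m + 2) (F (m + 1))).add
      ((isLead_monomial (m + 1) (derivEnd N (F (m + 1)))).add (ih ⟨F, rfl, rfl⟩)).succ
    rwa [add_zero] at h2

lemma IsLead.mul_del_pow {D : RightOp N} {m : ℕ} {f : MatPoly N} (hD : IsLead D m f) (k : ℕ) :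
    IsLead (D * del N ^ k) (m + k) f := by
  induction k with
  | zero => simpa using hD
  | succ k ih =>
    rw [pow_succ, ← mul_assoc]
    exact ih.mul_del

/-- Moving a coefficient past `∂` only creates terms of lower order, so leading coefficients
multiply. -/
lemma IsLead.mul {D E : RightOp N} {m n : ℕ} {f g : MatPoly N} (hD : IsLead D m f)
    (hE : IsLead E n g) : IsLead (D * E) (m + n) (f * g) := by
  obtain ⟨G, rfl, rfl⟩ := hE
  induction n with
  | zero => simpa [diffOp] using hD.mul_coef (G 0)
  | succ n ih =>
    rw [diffOp, Finset.sum_range_succ, mul_add, ← mul_assoc]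
    have h := ih.succ.add ((hD.mul_del_pow (n + 1)).mul_coef (G (n + 1)))
    rwa [zero_add] at h

end Action

/-! ### Expansion in sequences with nonsingular leading coefficients -/

section Regular

variable {N : ℕ}

lemma coeff_const_mul (A : Matrix (Fin N) (Fin N) ℂ) (P : MatPoly N) (n : ℕ) :
    ((A.map C * P).map fun p => p.coeff n) = A * P.map fun p => p.coeff n := by
  ext i j
  simp [Matrix.mul_apply]

lemma IsRegularOfDegree.const_mul_cancel {P : MatPoly N} {n : ℕ} (h : IsRegularOfDegree P n)
    {A B : Matrix (Fin N) (Fin N) ℂ} (hAB : A.map C * P = B.map C * P) : A = B := by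
  have := congrArg (fun R : MatPoly N => R.map fun p => p.coeff n) hAB
  simp only [coeff_const_mul] at this
  exact h.2.mul_right_cancel this

/-- The invertible leading coefficient of `Q n` allows the degree-`n` part to be removed by a left
constant factor; then induct. -/
lemma exists_expansion {Q : ℕ → MatPoly N} (hQ : ∀ n, IsRegularOfDegree (Q n) n) (n : ℕ)
    (P : MatPoly N) (hP : ∀ i j, (P i j).degree < n) :
    ∃ c : ℕ → Matrix (Fin N) (Fin N) ℂ, P = ∑ k ∈ Finset.range n, (c k).map C * Q k := by
  induction n generalizing P with
  | zero =>
    refine ⟨0, ?_⟩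
    ext1 i j
    simpa using hP i j
  | succ n ih =>
    obtain ⟨u, hu⟩ := (hQ n).2
    set A : Matrix (Fin N) (Fin N) ℂ := (P.map fun p => p.coeff n) * (↑u⁻¹ : Matrix _ _ ℂ) with hA
    have hc : ((A.map C * Q n).map fun p => p.coeff n) = P.map fun p => p.coeff n := by
      rw [coeff_const_mul, ← hu, hA, mul_assoc, Units.inv_mul, mul_one]
    have hdeg : ∀ i j, ((A.map C * Q n) i j).natDegree ≤ n := by
      intro i j
      rw [Matrix.mul_apply]
      refine Polynomial.natDegree_sum_le_of_forall_le _ _ fun k _ => ?_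
      exact (Polynomial.natDegree_C_mul_le _ _).trans ((hQ n).1 k j)
    obtain ⟨c, hc'⟩ := ih (P - A.map C * Q n) (by
      intro i j
      rw [Polynomial.degree_lt_iff_coeff_zero]
      intro m hm
      rcases Nat.eq_or_lt_of_le hm with rfl | hm
      · have := congrFun (congrFun hc i) j
        simp only [Matrix.map_apply] at this
        rw [Matrix.sub_apply, Polynomial.coeff_sub, this, sub_self]
      · rw [Matrix.sub_apply, Polynomial.coeff_sub,
          Polynomial.coeff_eq_zero_of_natDegree_lt ((hdeg i j).trans_lt hm),
          Polynomial.coeff_eq_zero_of_degree_lt ((hP i j).trans_le (by exact_mod_cast hm)),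
          sub_self])
    refine ⟨fun k => if k = n then A else c k, ?_⟩
    rw [Finset.sum_range_succ, ← sub_eq_iff_eq_add]
    simp only [if_true]
    rw [hc']
    refine Finset.sum_congr rfl fun k hk => ?_
    rw [if_neg (Finset.mem_range.mp hk).ne]

lemma exists_degree_lt (P : MatPoly N) : ∃ n : ℕ, ∀ i j, (P i j).degree < n := by
  refine ⟨(∑ i, ∑ j, (P i j).natDegree) + 1, fun i j => ?_⟩
  refine lt_of_le_of_lt Polynomial.degree_le_natDegree ?_
  have h1 : (P i j).natDegree ≤ ∑ j, (P i j).natDegree :=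
    Finset.single_le_sum (f := fun j => (P i j).natDegree) (fun _ _ => Nat.zero_le _)
      (Finset.mem_univ j)
  have h2 : ∑ j, (P i j).natDegree ≤ ∑ i, ∑ j, (P i j).natDegree :=
    Finset.single_le_sum (f := fun i => ∑ j, (P i j).natDegree) (fun _ _ => Nat.zero_le _)
      (Finset.mem_univ i)
  exact_mod_cast Nat.lt_succ_of_le (h1.trans h2)

lemma IsRegularOfDegree.degree_lt {P : MatPoly N} {n : ℕ} (h : IsRegularOfDegree P n)
    (i j : Fin N) : (P i j).degree < (n + 1 : ℕ) :=
  lt_of_le_of_lt Polynomial.degree_le_natDegree (by exact_mod_cast Nat.lt_succ_of_le (h.1 i j))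

/-- Differential operators commute with left multiplication by constants, so their values on the `Q
n` fix them on all matrix polynomials. This turns every operator identity below into an identity of
eigenvalues. -/
lemma IsDiffOp.ext_of_regular {Q : ℕ → MatPoly N} (hQ : ∀ n, IsRegularOfDegree (Q n) n)
    {D E : RightOp N} (hD : IsDiffOp D) (hE : IsDiffOp E) (h : ∀ n, act (Q n) D = act (Q n) E) :
    D = E := by
  refine ext_act fun P => ?_
  obtain ⟨n, hn⟩ := exists_degree_lt P
  obtain ⟨c, rfl⟩ := exists_expansion hQ n P hn
  simp only [sum_act, act_const_mul hD, act_const_mul hE, h]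

end Regular

/-! ### Matrix inner products, the algebra of a weight and its center -/

section Orthogonality

variable {N : ℕ}

/-- The conjugate transpose of a matrix polynomial in a real variable. -/
def conjT (P : MatPoly N) : MatPoly N := (P.map (Polynomial.map (starRingEnd ℂ))).transpose

lemma conjT_add (P Q : MatPoly N) : conjT (P + Q) = conjT P + conjT Q := by
  ext1 i j
  simp [conjT]

lemma conjT_mul (P Q : MatPoly N) : conjT (P * Q) = conjT Q * conjT P := by
  ext1 i j
  simp [conjT, Matrix.mul_apply, Polynomial.map_sum, mul_comm]

lemma conjT_const (A : Matrix (Fin N) (Fin N) ℂ) :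
    conjT (A.map C) = (A.conjTranspose).map C := by
  ext1 i j
  simp [conjT]

/-- The form of the weight `W` is `⟨P, Q⟩ = L(P Wp Q^*)` for a linear functional `L` on
polynomials and a polynomial matrix `Wp`. -/
def IsPolyForm (I : Set ℝ) (W : ℝ → Matrix (Fin N) (Fin N) ℂ) (L : ℂ[X] →ₗ[ℂ] ℂ)
    (Wp : MatPoly N) : Prop :=
  ∀ P Q, form I W P Q = (P * Wp * conjT Q).map L

variable {I : Set ℝ} {W : ℝ → Matrix (Fin N) (Fin N) ℂ} {L : ℂ[X] →ₗ[ℂ] ℂ} {Wp : MatPoly N}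

lemma map_const_mul (L : ℂ[X] →ₗ[ℂ] ℂ) (A : Matrix (Fin N) (Fin N) ℂ) (P : MatPoly N) :
    (A.map C * P).map L = A * P.map L := by
  ext i j
  simp [Matrix.mul_apply, map_sum, ← Polynomial.smul_eq_C_mul]

lemma map_mul_const (L : ℂ[X] →ₗ[ℂ] ℂ) (A : Matrix (Fin N) (Fin N) ℂ) (P : MatPoly N) :
    (P * A.map C).map L = P.map L * A := by
  ext i j
  simp only [Matrix.mul_apply, Matrix.map_apply, map_sum]
  refine Finset.sum_congr rfl fun k _ => ?_
  rw [mul_comm, ← Polynomial.smul_eq_C_mul, map_smul, smul_eq_mul, mul_comm]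

lemma IsPolyForm.const_mul_left (hW : IsPolyForm I W L Wp) (A : Matrix (Fin N) (Fin N) ℂ)
    (P Q : MatPoly N) : form I W (A.map C * P) Q = A * form I W P Q := by
  rw [hW, hW, mul_assoc, mul_assoc, map_const_mul, mul_assoc]

lemma IsPolyForm.const_mul_right (hW : IsPolyForm I W L Wp) (A : Matrix (Fin N) (Fin N) ℂ)
    (P Q : MatPoly N) : form I W P (A.map C * Q) = form I W P Q * A.conjTranspose := by
  rw [hW, hW, conjT_mul, conjT_const, ← mul_assoc, map_mul_const]

lemma IsPolyForm.add_left (hW : IsPolyForm I W L Wp) (P P' Q : MatPoly N) :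
    form I W (P + P') Q = form I W P Q + form I W P' Q := by
  rw [hW, hW, hW, add_mul, add_mul, Matrix.map_add _ (map_add L)]

lemma IsPolyForm.add_right (hW : IsPolyForm I W L Wp) (P Q Q' : MatPoly N) :
    form I W P (Q + Q') = form I W P Q + form I W P Q' := by
  rw [hW, hW, hW, conjT_add, mul_add, Matrix.map_add _ (map_add L)]

lemma IsPolyForm.sum_left (hW : IsPolyForm I W L Wp) {ι : Type*} (s : Finset ι)
    (P : ι → MatPoly N) (Q : MatPoly N) :
    form I W (∑ i ∈ s, P i) Q = ∑ i ∈ s, form I W (P i) Q :=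
  map_sum (AddMonoidHom.mk' (fun P => form I W P Q) fun P P' => hW.add_left P P' Q) P s

lemma IsPolyForm.sum_right (hW : IsPolyForm I W L Wp) {ι : Type*} (s : Finset ι)
    (P : MatPoly N) (Q : ι → MatPoly N) :
    form I W P (∑ i ∈ s, Q i) = ∑ i ∈ s, form I W P (Q i) :=
  map_sum (AddMonoidHom.mk' (fun Q => form I W P Q) fun Q Q' => hW.add_right P Q Q') Q s

/-- Orthogonal sequences are unique up to invertible constants. -/
lemma IsOrthogonalSeq.unique (hW : IsPolyForm I W L Wp) {Q₀ Q : ℕ → MatPoly N}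
    (h₀ : IsOrthogonalSeq I W Q₀) (hu : ∀ n, IsUnit (form I W (Q₀ n) (Q₀ n)))
    (hQ : IsOrthogonalSeq I W Q) (n : ℕ) :
    ∃ u : (Matrix (Fin N) (Fin N) ℂ)ˣ,
      Q n = (u : Matrix (Fin N) (Fin N) ℂ).map C * Q₀ n := by
  obtain ⟨c, hc⟩ := exists_expansion h₀.1 (n + 1) (Q n) (hQ.1 n).degree_lt
  have hz : ∀ j < n, c j = 0 := by
    intro j hj
    -- `Q₀ j` is a combination of `Q 0, …, Q j`, all orthogonal to `Q n` because `j < n`.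
    have h1 : form I W (Q n) (Q₀ j) = 0 := by
      obtain ⟨d, hd⟩ := exists_expansion hQ.1 (j + 1) (Q₀ j) (h₀.1 j).degree_lt
      rw [hd, hW.sum_right]
      refine Finset.sum_eq_zero fun k hk => ?_
      have := Finset.mem_range.mp hk
      rw [hW.const_mul_right, hQ.2 n k (by omega), zero_mul]
    rw [hc, hW.sum_left, Finset.sum_eq_single j] at h1
    · rw [hW.const_mul_left] at h1
      exact (hu j).mul_left_eq_zero.mp h1
    · intro k _ hk
      rw [hW.const_mul_left, h₀.2 k j hk, mul_zero]
    · intro h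
      simp at h
      omega
  have hn : Q n = (c n).map C * Q₀ n := by
    conv_lhs => rw [hc]
    rw [Finset.sum_range_succ, Finset.sum_eq_zero, zero_add]
    intro k hk
    rw [hz k (Finset.mem_range.mp hk)]
    simp
  have hunit : IsUnit (c n) := by
    have h1 := (hQ.1 n).2
    rw [hn, coeff_const_mul] at h1
    rw [Matrix.isUnit_iff_isUnit_det] at h1 ⊢
    rw [Matrix.det_mul] at h1
    exact isUnit_of_mul_isUnit_left h1
  obtain ⟨u, hu'⟩ := hunit
  exact ⟨u, by rw [hn, hu']⟩

/-- Replacing `Q₀ n` by `u Q₀ n` conjugates the eigenvalue by `u`, so one orthogonal sequence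
suffices. -/
lemma mem_algD_iff (hW : IsPolyForm I W L Wp) {Q₀ : ℕ → MatPoly N}
    (h₀ : IsOrthogonalSeq I W Q₀) (hu : ∀ n, IsUnit (form I W (Q₀ n) (Q₀ n))) (D : RightOp N) :
    D ∈ algD I W ↔ IsDiffOp D ∧ ∀ n, IsEigen (Q₀ n) D := by
  refine ⟨fun h => ⟨h.1, h.2 Q₀ h₀⟩, fun h => ⟨h.1, fun Q hQ n => ?_⟩⟩
  obtain ⟨u, hu'⟩ := h₀.unique hW hu hQ n
  obtain ⟨A, hA⟩ := h.2 n
  refine ⟨u * A * (↑u⁻¹ : Matrix (Fin N) (Fin N) ℂ), ?_⟩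
  rw [hu', act_const_mul h.1, hA, ← mul_assoc, ← mul_assoc, ← Matrix.map_mul, ← Matrix.map_mul,
    mul_assoc _ _ (u : Matrix (Fin N) (Fin N) ℂ), Units.inv_mul, mul_one]

lemma map_C_smul_one (c : ℂ) :
    ((c • (1 : Matrix (Fin N) (Fin N) ℂ)).map C) = c • (1 : MatPoly N) := by
  ext1 i j
  by_cases h : i = j
  · subst h
    simp [Polynomial.smul_eq_C_mul]
  · simp [h]

/-- If `𝒟(W)` realizes all constant matrices as eigenvalues at each degree, then its center
consists of the differential operators with scalar eigenvalues. -/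
lemma mem_centerD_iff (hW : IsPolyForm I W L Wp) {Q₀ : ℕ → MatPoly N}
    (h₀ : IsOrthogonalSeq I W Q₀) (hu : ∀ n, IsUnit (form I W (Q₀ n) (Q₀ n)))
    (hG : ∀ n (G : Matrix (Fin N) (Fin N) ℂ), ∃ D ∈ algD I W, act (Q₀ n) D = G.map C * Q₀ n)
    (D : RightOp N) :
    D ∈ centerD I W ↔ IsDiffOp D ∧ ∀ n, ∃ c : ℂ, act (Q₀ n) D = c • Q₀ n := by
  have hmem : D ∈ centerD I W ↔ D ∈ algD I W ∧ ∀ E ∈ algD I W, E * D = D * E := by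
    simp only [centerD, Subalgebra.mem_map, Subalgebra.mem_center_iff]
    constructor
    · rintro ⟨⟨x, hx⟩, h, rfl⟩
      exact ⟨hx, fun E hE => congrArg Subtype.val (h ⟨E, hE⟩)⟩
    · rintro ⟨hD, h⟩
      exact ⟨⟨D, hD⟩, fun b => Subtype.ext (h b b.2), rfl⟩
  rw [hmem]
  constructor
  · rintro ⟨hD, h⟩
    rw [mem_algD_iff hW h₀ hu] at hD
    refine ⟨hD.1, fun n => ?_⟩
    obtain ⟨A, hA⟩ := hD.2 n
    -- An operator `E` realizing an arbitrary `G` at degree `n` commutes with `D`; comparing both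
    -- orders on `Q₀ n` gives `G A = A G`.
    have hA' : A ∈ Set.center (Matrix (Fin N) (Fin N) ℂ) := by
      rw [Semigroup.mem_center_iff]
      intro G
      obtain ⟨E, hE, hEG⟩ := hG n G
      have h1 := congrArg (act (Q₀ n)) (h E hE)
      rw [act_mul, act_mul, hEG, hA, act_const_mul hD.1, act_const_mul hE.1, hA, hEG,
        ← mul_assoc, ← mul_assoc, ← Matrix.map_mul, ← Matrix.map_mul] at h1
      exact (h₀.1 n).const_mul_cancel h1
    rw [Matrix.center_eq_range] at hA'
    obtain ⟨c, rfl⟩ := hA'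
    refine ⟨c, ?_⟩
    rw [hA]
    have : Matrix.scalar (Fin N) c = c • (1 : Matrix (Fin N) (Fin N) ℂ) := by
      rw [Matrix.smul_one_eq_diagonal]; rfl
    rw [this, map_C_smul_one, smul_mul_assoc, one_mul]
  · rintro ⟨hD, h⟩
    have hDmem : D ∈ algD I W := by
      rw [mem_algD_iff hW h₀ hu]
      refine ⟨hD, fun n => ?_⟩
      obtain ⟨c, hc⟩ := h n
      exact ⟨c • 1, by rw [hc, map_C_smul_one, smul_mul_assoc, one_mul]⟩
    refine ⟨hDmem, fun E hE => ?_⟩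
    refine IsDiffOp.ext_of_regular h₀.1 (hE.1.mul hD) (hD.mul hE.1) fun n => ?_
    obtain ⟨A, hA⟩ := hE.2 Q₀ h₀ n
    obtain ⟨c, hc⟩ := h n
    rw [act_mul, act_mul, hA, hc, act_const_mul hD, hc, smul_act, hA, mul_smul_comm]

end Orthogonality

/-! ### Integration against the scalar Jacobi weight -/

section Weight

open MeasureTheory Set

/-- The scalar Jacobi weight. -/
def jacobiWeight (α β x : ℝ) : ℝ := (1 - x) ^ α * (1 + x) ^ β

/-- Splitting at `0` leaves only one possibly singular factor on each half. -/
lemma intervalIntegrable_jacobiWeight {α β : ℝ} (hα : -1 < α) (hβ : -1 < β) :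
    IntervalIntegrable (jacobiWeight α β) volume (-1) 1 := by
  have h1 : IntervalIntegrable (jacobiWeight α β) volume (-1) 0 := by
    have h : IntervalIntegrable (fun x : ℝ => (1 + x) ^ β) volume (-1) 0 := by
      have := (intervalIntegral.intervalIntegrable_rpow' (a := 0) (b := 1) hβ).comp_add_left 1
      simpa using this
    refine h.continuousOn_mul (ContinuousOn.rpow_const (by fun_prop) fun x hx => Or.inl ?_)
    rw [uIcc_of_le (by norm_num)] at hx
    have := hx.2
    linarith
  have h2 : IntervalIntegrable (jacobiWeight α β) volume 0 1 := by
    have h : IntervalIntegrable (fun x : ℝ => (1 - x) ^ α) volume 0 1 := by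
      have := (intervalIntegral.intervalIntegrable_rpow' (a := 0) (b := 1) hα).comp_sub_left 1
      simpa using this.symm
    refine h.mul_continuousOn (ContinuousOn.rpow_const (by fun_prop) fun x hx => Or.inl ?_)
    rw [uIcc_of_le (by norm_num)] at hx
    have := hx.1
    linarith
  exact h1.trans h2

lemma integrableOn_poly_mul_jacobiWeight {α β : ℝ} (hα : -1 < α) (hβ : -1 < β) (p : ℂ[X]) :
    IntegrableOn (fun x : ℝ => p.eval (x : ℂ) * (jacobiWeight α β x : ℂ)) (Ioo (-1) 1) := by
  have h1 : IntervalIntegrable (fun x : ℝ => (jacobiWeight α β x : ℂ)) volume (-1) 1 := by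
    have h := intervalIntegrable_jacobiWeight hα hβ
    exact ⟨h.1.ofReal, h.2.ofReal⟩
  have hc : Continuous fun x : ℝ => p.eval (x : ℂ) := p.continuous.comp Complex.continuous_ofReal
  have h2 := h1.continuousOn_mul hc.continuousOn
  rw [intervalIntegrable_iff_integrableOn_Ioo_of_le (by norm_num)] at h2
  exact h2

/-- Integration of a polynomial against the Jacobi weight. -/
def jacobiInt {α β : ℝ} (hα : -1 < α) (hβ : -1 < β) : ℂ[X] →ₗ[ℂ] ℂ where
  toFun p := ∫ x in Ioo (-1 : ℝ) 1, p.eval (x : ℂ) * (jacobiWeight α β x : ℂ)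
  map_add' p q := by
    rw [← integral_add (integrableOn_poly_mul_jacobiWeight hα hβ p)
      (integrableOn_poly_mul_jacobiWeight hα hβ q)]
    simp only [eval_add, add_mul]
  map_smul' c p := by
    rw [RingHom.id_apply, ← integral_smul]
    simp only [eval_smul, smul_eq_mul, mul_assoc]

lemma jacobiInt_apply {α β : ℝ} (hα : -1 < α) (hβ : -1 < β) (p : ℂ[X]) :
    jacobiInt hα hβ p = ∫ x in Ioo (-1 : ℝ) 1, p.eval (x : ℂ) * (jacobiWeight α β x : ℂ) := rfl

/-- The Pearson identity for the Jacobi weight. -/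
lemma jacobiInt_pearson {α β : ℝ} (hα : -1 < α) (hβ : -1 < β) (T : ℂ[X]) :
    jacobiInt hα hβ ((1 - X ^ 2) * derivative T + (rC (β - α) - X * rC (α + β + 2)) * T) = 0 := by
  set p : ℂ[X] := (1 - X ^ 2) * derivative T + (rC (β - α) - X * rC (α + β + 2)) * T with hp
  -- An antiderivative of the integrand. Its exponents `α+1, β+1` are positive, so it is continuous
  -- up to `±1` and vanishes there.
  set F : ℝ → ℂ := fun x => T.eval (x : ℂ) * (((1 - x) ^ (α + 1) * (1 + x) ^ (β + 1) : ℝ) : ℂ)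
    with hF
  have hcont : ContinuousOn F (Icc (-1) 1) := by
    have hT : Continuous fun x : ℝ => T.eval (x : ℂ) :=
      T.continuous.comp Complex.continuous_ofReal
    have hw : Continuous fun x : ℝ => (1 - x) ^ (α + 1) * (1 + x) ^ (β + 1) :=
      ((continuous_const.sub continuous_id).rpow_const fun _ => Or.inr (by linarith)).mul
        ((continuous_const.add continuous_id).rpow_const fun _ => Or.inr (by linarith))
    exact (hT.mul (Complex.continuous_ofReal.comp hw)).continuousOn
  have hderiv : ∀ x ∈ Ioo (-1 : ℝ) 1,
      HasDerivAt F (p.eval (x : ℂ) * (jacobiWeight α β x : ℂ)) x := by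
    intro x hx
    have h1 : 0 < 1 - x := by linarith [hx.2]
    have h2 : 0 < 1 + x := by linarith [hx.1]
    have hT : HasDerivAt (fun x : ℝ => T.eval (x : ℂ)) (T.derivative.eval (x : ℂ)) x :=
      (T.hasDerivAt (x : ℂ)).comp_ofReal
    have ha : HasDerivAt (fun x : ℝ => (1 - x) ^ (α + 1)) (-1 * (α + 1) * (1 - x) ^ α) x := by
      have := ((hasDerivAt_id x).const_sub 1).rpow_const (p := α + 1) (Or.inl h1.ne')
      simpa using this
    have hb : HasDerivAt (fun x : ℝ => (1 + x) ^ (β + 1)) (1 * (β + 1) * (1 + x) ^ β) x := by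
      have := ((hasDerivAt_id x).const_add 1).rpow_const (p := β + 1) (Or.inl h2.ne')
      simpa using this
    have h := hT.mul (ha.mul hb).ofReal_comp
    refine HasDerivAt.congr_deriv h ?_
    simp only [Pi.mul_apply]
    rw [Real.rpow_add h1, Real.rpow_add h2, Real.rpow_one, Real.rpow_one, hp, jacobiWeight]
    simp only [eval_add, eval_mul, eval_sub, eval_one, eval_pow, eval_X, rC, eval_C]
    push_cast
    ring
  have hint := integrableOn_poly_mul_jacobiWeight hα hβ p
  rw [← intervalIntegrable_iff_integrableOn_Ioo_of_le (by norm_num)] at hint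
  have h := intervalIntegral.integral_eq_sub_of_hasDerivAt_of_le (by norm_num) hcont hderiv hint
  rw [jacobiInt_apply, ← integral_Ioc_eq_integral_Ioo,
    ← intervalIntegral.integral_of_le (by norm_num), h, hF]
  have h1 : α + 1 ≠ 0 := by linarith
  have h2 : β + 1 ≠ 0 := by linarith
  simp [Real.zero_rpow h1, Real.zero_rpow h2]

/-- The integrand is `|p|²` times a positive weight, hence positive off the finitely many zeros of
`p`. -/
lemma jacobiInt_mul_conj_ne_zero {α β : ℝ} (hα : -1 < α) (hβ : -1 < β) {p : ℂ[X]} (hp : p ≠ 0) :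
    jacobiInt hα hβ ((1 - X ^ 2) * (p * p.map (starRingEnd ℂ))) ≠ 0 := by
  set f : ℝ → ℝ := fun x => (1 - x ^ 2) * Complex.normSq (p.eval (x : ℂ)) * jacobiWeight α β x
    with hf
  have hfe : ∀ x : ℝ, ((1 - X ^ 2) * (p * p.map (starRingEnd ℂ))).eval (x : ℂ)
      * (jacobiWeight α β x : ℂ) = (f x : ℂ) := by
    intro x
    have hc : (p.map (starRingEnd ℂ)).eval (x : ℂ) = (starRingEnd ℂ) (p.eval (x : ℂ)) := by
      have := Polynomial.eval_map_apply (p := p) (starRingEnd ℂ) (x : ℂ)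
      rwa [Complex.conj_ofReal] at this
    simp only [eval_mul, eval_sub, eval_one, eval_pow, eval_X, hc, Complex.mul_conj, hf]
    push_cast
    ring
  have hpos : ∀ x ∈ Ioo (-1 : ℝ) 1, 0 < (1 - x ^ 2) * jacobiWeight α β x := by
    intro x hx
    have h1 : 0 < 1 - x := by linarith [hx.2]
    have h2 : 0 < 1 + x := by linarith [hx.1]
    have h3 : 0 < 1 - x ^ 2 := by nlinarith
    exact mul_pos h3 (mul_pos (Real.rpow_pos_of_pos h1 _) (Real.rpow_pos_of_pos h2 _))
  have hfi : IntegrableOn f (Ioo (-1) 1) := by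
    have h := (integrableOn_poly_mul_jacobiWeight hα hβ
      ((1 - X ^ 2) * (p * p.map (starRingEnd ℂ)))).re
    simp only [hfe] at h
    simpa [IntegrableOn] using h
  have hnn : 0 ≤ᵐ[volume.restrict (Ioo (-1) 1)] f := by
    refine (ae_restrict_iff' measurableSet_Ioo).mpr (Filter.Eventually.of_forall fun x hx => ?_)
    have := mul_nonneg (hpos x hx).le (Complex.normSq_nonneg (p.eval (x : ℂ)))
    simp only [hf, Pi.zero_apply]
    linarith
  have hint : 0 < ∫ x in Ioo (-1 : ℝ) 1, f x := by
    rw [setIntegral_pos_iff_support_of_nonneg_ae hnn hfi]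
    have hfin : {x : ℝ | p.eval (x : ℂ) = 0}.Finite := by
      have h : {z : ℂ | p.IsRoot z}.Finite := Polynomial.finite_setOfPred_isRoot hp
      exact h.preimage Complex.ofReal_injective.injOn
    have hsub : Ioo (-1 : ℝ) 1 \ {x : ℝ | p.eval (x : ℂ) = 0} ⊆
        Function.support f ∩ Ioo (-1) 1 := by
      rintro x ⟨hx, hx0⟩
      refine ⟨?_, hx⟩
      have := mul_pos (hpos x hx) (Complex.normSq_pos.mpr hx0)
      simp only [hf, Function.mem_support]
      nlinarith
    refine lt_of_lt_of_le ?_ (measure_mono hsub)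
    rw [measure_sdiff_null (hfin.measure_zero volume)]
    simp
  rw [jacobiInt_apply]
  simp only [hfe]
  rw [integral_complex_ofReal]
  exact_mod_cast hint.ne'

end Weight

/-! ### Both weights as polynomial multiples of one scalar weight -/

section Forms

variable {N : ℕ}

lemma evalAt_mul (P Q : MatPoly N) (x : ℝ) : evalAt (P * Q) x = evalAt P x * evalAt Q x :=
  Matrix.map_mul (f := Polynomial.evalRingHom (x : ℂ))

lemma conjTranspose_evalAt (Q : MatPoly N) (x : ℝ) :
    (evalAt Q x).conjTranspose = evalAt (conjT Q) x := by
  ext i j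
  have := Polynomial.eval_map_apply (p := Q j i) (starRingEnd ℂ) (x : ℂ)
  rw [Complex.conj_ofReal] at this
  simpa [evalAt, conjT] using this.symm

lemma isPolyForm_of_eq {α β : ℝ} (hα : -1 < α) (hβ : -1 < β)
    {W : ℝ → Matrix (Fin N) (Fin N) ℂ} {Wp : MatPoly N}
    (h : ∀ x ∈ Set.Ioo (-1 : ℝ) 1, W x = (jacobiWeight α β x : ℂ) • evalAt Wp x) :
    IsPolyForm (Set.Ioo (-1) 1) W (jacobiInt hα hβ) Wp := by
  intro P Q
  ext i j
  rw [Matrix.map_apply, jacobiInt_apply, form, Matrix.of_apply]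
  refine MeasureTheory.setIntegral_congr_fun measurableSet_Ioo fun x hx => ?_
  rw [h x hx, conjTranspose_evalAt, mul_smul_comm, smul_mul_assoc, ← evalAt_mul, ← evalAt_mul,
    Matrix.smul_apply, smul_eq_mul, mul_comm]
  rfl

/-- The polynomial factor of the weight `W`. -/
def polyW (α β v : ℝ) : MatPoly 2 :=
  !![rC (v * (v + 2 + α + β) / (v + α - β) / 4) * (1 - X) ^ 2
        - rC ((v + α + β + 2) / 2) * (1 - X) + rC (α + 1),
      rC ((α + β + 2) / 2) * (1 - X) - rC (α + 1);
     rC ((α + β + 2) / 2) * (1 - X) - rC (α + 1),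
      rC (v * (-v + 2 + α + β) / (v - α + β) / 4) * (1 - X) ^ 2
        - rC ((-v + α + β + 2) / 2) * (1 - X) + rC (α + 1)]

lemma isPolyForm_jacobiW {α β : ℝ} (hα : -1 < α) (hβ : -1 < β) (v : ℝ) :
    IsPolyForm (Set.Ioo (-1) 1) (jacobiW α β v) (jacobiInt hα hβ) (polyW α β v) := by
  refine isPolyForm_of_eq hα hβ fun x _ => ?_
  ext i j
  fin_cases i <;> fin_cases j <;>
    simp [jacobiW, polyW, evalAt, jacobiWeight, rC] <;> left <;> ring

/-- The factor `1 - x²` absorbs the shift of both exponents, so both forms use the same functional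
and can be compared algebraically. -/
lemma isPolyForm_jacobiWt {α β : ℝ} (hα : -1 < α) (hβ : -1 < β) :
    IsPolyForm (Set.Ioo (-1) 1) (jacobiWt α β) (jacobiInt hα hβ)
      ((1 - X ^ 2 : ℂ[X]) • (1 : MatPoly 2)) := by
  refine isPolyForm_of_eq hα hβ fun x hx => ?_
  have h1 : 0 < 1 - x := by linarith [hx.2]
  have h2 : 0 < 1 + x := by linarith [hx.1]
  ext i j
  fin_cases i <;> fin_cases j <;>
    simp [jacobiWt, evalAt, jacobiWeight, Real.rpow_add h1, Real.rpow_add h2] <;> ring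

end Forms

/-! ### Scalar Jacobi polynomials -/

section JacobiPolynomials

/-- The scalar Jacobi operator. -/
def jacobiOp (a b : ℝ) (p : ℂ[X]) : ℂ[X] :=
  (1 - X ^ 2) * derivative (derivative p) + (rC (b - a) - X * rC (a + b + 2)) * derivative p

/-- The eigenvalues of the scalar Jacobi operator. -/
def jacobiEig (a b : ℝ) (n : ℕ) : ℂ := -((n : ℂ) * (n + a + b + 1))

/-- The coefficients, in powers of `1 - x`, of the formal eigenfunction of the Jacobi operator with
eigenvalue `t`. -/
def jacobiCoeff (a b : ℝ) (t : ℂ) : ℕ → ℂ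
  | 0 => 1
  | k + 1 => jacobiCoeff a b t k * (((k : ℂ) * (k + a + b + 1) + t) / (2 * (k + 1) * (k + 1 + a)))

/-- The Jacobi polynomials, normalized to have value `1` at `x = 1`. -/
def jacobiP (a b : ℝ) (n : ℕ) : ℂ[X] :=
  ∑ k ∈ Finset.range (n + 1), C (jacobiCoeff a b (jacobiEig a b n) k) * (1 - X) ^ k

variable {a b : ℝ}

lemma jacobiOp_add (p q : ℂ[X]) : jacobiOp a b (p + q) = jacobiOp a b p + jacobiOp a b q := by
  simp only [jacobiOp, derivative_add]
  ring

lemma jacobiOp_C_mul (c : ℂ) (p : ℂ[X]) : jacobiOp a b (C c * p) = C c * jacobiOp a b p := by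
  simp only [jacobiOp, derivative_C_mul]
  ring

lemma rC_add (r s : ℝ) : rC (r + s) = rC r + rC s := by simp [rC]

lemma rC_sub (r s : ℝ) : rC (r - s) = rC r - rC s := by simp [rC]

lemma rC_one : rC 1 = 1 := by simp [rC]

lemma jacobiOp_zero_pow : jacobiOp a b ((1 - X) ^ 0) = 0 := by
  simp [jacobiOp]

/-- In powers of `1 - x` the operator has only two terms; this is the source of the recursion
defining `jacobiCoeff`. -/
lemma jacobiOp_succ_pow (k : ℕ) : jacobiOp a b ((1 - X) ^ (k + 1)) =
    C (-((k + 1 : ℂ) * (k + 1 + a + b + 1))) * (1 - X) ^ (k + 1)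
      + C (2 * (k + 1 : ℂ) * (k + 1 + a)) * (1 - X) ^ k := by
  have h1 : derivative ((1 - X : ℂ[X]) ^ (k + 1)) = -(((k : ℂ[X]) + 1) * (1 - X) ^ k) := by
    rw [derivative_pow_succ]
    simp
  -- Multiplying by `1 - X` avoids the exponent `k - 1` in natural numbers.
  have h2 : (1 - X : ℂ[X]) * derivative ((1 - X : ℂ[X]) ^ k) = -((k : ℂ[X]) * (1 - X) ^ k) := by
    rw [derivative_pow]
    cases k with
    | zero => simp
    | succ k => simp [pow_succ]; ring
  have h3 : derivative (-(((k : ℂ[X]) + 1) * (1 - X) ^ k))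
      = -((k : ℂ[X]) + 1) * derivative ((1 - X : ℂ[X]) ^ k) := by
    rw [← neg_mul, derivative_mul]
    simp
  rw [jacobiOp, h1, h3]
  have h4 : (1 - X ^ 2 : ℂ[X]) * (-((k : ℂ[X]) + 1) * derivative ((1 - X : ℂ[X]) ^ k))
      = (1 + X) * (-((k : ℂ[X]) + 1)) * -((k : ℂ[X]) * (1 - X) ^ k) := by
    rw [← h2]; ring
  rw [h4]
  simp only [rC, Complex.ofReal_add, Complex.ofReal_sub, Complex.ofReal_ofNat, map_add, map_sub,
    map_mul, map_neg, map_natCast, map_one, map_ofNat]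
  ring

lemma jacobiCoeff_succ_mul (ha : -1 < a) (t : ℂ) (k : ℕ) :
    jacobiCoeff a b t (k + 1) * (2 * (k + 1) * (k + 1 + a))
      = jacobiCoeff a b t k * ((k : ℂ) * (k + a + b + 1) + t) := by
  have h1 : ((k : ℂ) + 1) ≠ 0 := Nat.cast_add_one_ne_zero k
  have h2 : ((k : ℂ) + 1 + a) ≠ 0 := by
    have : (0 : ℝ) < k + 1 + a := by
      have := Nat.cast_nonneg (α := ℝ) k
      linarith
    exact_mod_cast this.ne'
  rw [jacobiCoeff]
  field_simp

/-- The recursion cancels all intermediate terms and leaves a remainder at the top power, which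
vanishes when `t` is the eigenvalue of index `m`. -/
lemma jacobiOp_partial_sum (ha : -1 < a) (t : ℂ) (m : ℕ) :
    jacobiOp a b (∑ k ∈ Finset.range (m + 1), C (jacobiCoeff a b t k) * (1 - X) ^ k)
      = C t * ∑ k ∈ Finset.range (m + 1), C (jacobiCoeff a b t k) * (1 - X) ^ k
        - C (jacobiCoeff a b t m * ((m : ℂ) * (m + a + b + 1) + t)) * (1 - X) ^ m := by
  induction m with
  | zero =>
    simp only [zero_add, Finset.sum_range_one, jacobiOp_C_mul, jacobiOp_zero_pow]
    simp
    ring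
  | succ m ih =>
    rw [Finset.sum_range_succ, jacobiOp_add, ih, jacobiOp_C_mul, jacobiOp_succ_pow,
      ← jacobiCoeff_succ_mul ha]
    push_cast
    simp only [map_add, map_mul, map_neg, map_natCast, map_one, map_ofNat]
    ring

lemma jacobiOp_jacobiP (ha : -1 < a) (n : ℕ) :
    jacobiOp a b (jacobiP a b n) = C (jacobiEig a b n) * jacobiP a b n := by
  rw [jacobiP, jacobiOp_partial_sum ha]
  simp [jacobiEig]

lemma eval_one_jacobiP (n : ℕ) : (jacobiP a b n).eval 1 = 1 := by
  rw [jacobiP, Finset.sum_range_succ']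
  simp [eval_finsetSum, jacobiCoeff]

lemma natDegree_jacobiP_le (n : ℕ) : (jacobiP a b n).natDegree ≤ n := by
  refine natDegree_sum_le_of_forall_le _ _ fun k hk => ?_
  refine (natDegree_C_mul_le _ _).trans ?_
  have h : (1 - X : ℂ[X]).natDegree ≤ 1 := by compute_degree
  refine (natDegree_pow_le_of_le k h).trans ?_
  have := Finset.mem_range.mp hk
  omega

lemma jacobiEig_sub (m n : ℕ) : jacobiEig a b n - jacobiEig a b m
    = ((m : ℂ) - n) * (m + n + a + b + 1) := by
  simp only [jacobiEig]
  ring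

/-- The difference of two eigenvalues factors; for distinct indices `m + n ≥ 1`, so `m + n + a + b +
1 > 0`. -/
lemma jacobiEig_injective (ha : -1 < a) (hb : -1 < b) : Function.Injective (jacobiEig a b) := by
  intro m n h
  by_contra hmn
  have h1 := jacobiEig_sub (a := a) (b := b) m n
  rw [h, sub_self, eq_comm, mul_eq_zero] at h1
  rcases h1 with h1 | h1
  · exact hmn (by exact_mod_cast sub_eq_zero.mp h1)
  · have h2 : (1 : ℝ) ≤ m + n := by
      have : 1 ≤ m + n := by omega
      exact_mod_cast this
    have h3 : (0 : ℝ) < m + n + a + b + 1 := by linarith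
    exact h3.ne' (by exact_mod_cast h1)

/-- Passing from `k` to `k + 1` multiplies by a nonzero multiple of the difference of the `n`-th and
`k`-th eigenvalues, nonzero for `k < n`. -/
lemma jacobiCoeff_ne_zero (ha : -1 < a) (hb : -1 < b) (n k : ℕ) (hk : k ≤ n) :
    jacobiCoeff a b (jacobiEig a b n) k ≠ 0 := by
  induction k with
  | zero => simp [jacobiCoeff]
  | succ k ih =>
    intro h
    have h1 := jacobiCoeff_succ_mul (b := b) ha (jacobiEig a b n) k
    rw [h, zero_mul, eq_comm, mul_eq_zero] at h1
    have h2 : (k : ℂ) * (k + a + b + 1) + jacobiEig a b n = jacobiEig a b n - jacobiEig a b k := by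
      simp only [jacobiEig]
      ring
    rw [h2, sub_eq_zero] at h1
    have := h1.resolve_left (ih (by omega))
    have := jacobiEig_injective ha hb this
    omega

lemma coeff_jacobiP_ne_zero (ha : -1 < a) (hb : -1 < b) (n : ℕ) :
    (jacobiP a b n).coeff n ≠ 0 := by
  have h : (1 - X : ℂ[X]).natDegree ≤ 1 := by compute_degree
  have h2 : ((1 - X : ℂ[X]) ^ n).coeff n = (-1) ^ n := by
    have := coeff_pow_of_natDegree_le (m := n) h
    rw [mul_one] at this
    rw [this]
    simp [coeff_X, coeff_one]
  rw [jacobiP, finsetSum_coeff, Finset.sum_range_succ, Finset.sum_eq_zero, zero_add, coeff_C_mul, h2]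
  · exact mul_ne_zero (jacobiCoeff_ne_zero ha hb n n le_rfl) (pow_ne_zero _ (by norm_num))
  · intro k hk
    rw [coeff_C_mul, coeff_eq_zero_of_natDegree_lt, mul_zero]
    refine (natDegree_pow_le_of_le k h).trans_lt ?_
    have := Finset.mem_range.mp hk
    omega

lemma jacobiP_ne_zero (n : ℕ) : jacobiP a b n ≠ 0 := by
  intro h
  have := eval_one_jacobiP (a := a) (b := b) n
  simp [h] at this

/-- The derivatives of an eigenfunction satisfy differentiated equations. -/
lemma jacobiOp_iterate_derivative {p : ℂ[X]} {t : ℂ} (h : jacobiOp a b p = C t * p) (i : ℕ) :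
    (1 - X ^ 2) * derivative^[i + 2] p
      + (rC (b - a) - X * rC (a + b + 2) - 2 * (i : ℂ[X]) * X) * derivative^[i + 1] p
      - (i : ℂ[X]) * ((i : ℂ[X]) + rC (a + b + 1)) * derivative^[i] p = C t * derivative^[i] p := by
  induction i with
  | zero =>
    simpa [jacobiOp] using h
  | succ i ih =>
    have h2 := congrArg derivative ih
    simp only [derivative_add, derivative_sub, derivative_mul, derivative_C, derivative_X,
      derivative_natCast, derivative_one, derivative_X_sq, derivative_ofNat, rC,
      ← Function.iterate_succ_apply' derivative] at h2
    simp only [rC]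
    push_cast at h2 ⊢
    simp only [map_add, map_sub, map_one, map_ofNat] at h2 ⊢
    linear_combination h2

/-- The derivatives of the Jacobi polynomials at `x = 1` are polynomials in the eigenvalue. -/
lemma exists_iterate_derivative_jacobiP (ha : -1 < a) (i : ℕ) :
    ∃ J : ℂ[X], ∀ n, (derivative^[i] (jacobiP a b n)).eval 1 = J.eval (jacobiEig a b n) := by
  induction i with
  | zero => exact ⟨1, fun n => by simp [eval_one_jacobiP]⟩
  | succ i ih =>
    obtain ⟨J, hJ⟩ := ih
    -- At `x = 1` the second-order term of the differentiated equation drops out and `p^{(i+1)}` has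
    -- coefficient `-2(a+1+i)`; solving for it gives this witness.
    refine ⟨C (-(2 * ((a : ℂ) + 1 + i))⁻¹) * ((X + C ((i : ℂ) * (i + a + b + 1))) * J), fun n => ?_⟩
    have h := congrArg (eval 1) (jacobiOp_iterate_derivative (jacobiOp_jacobiP (b := b) ha n) i)
    have hne : ((a : ℂ) + 1 + i) ≠ 0 := by
      have : (0 : ℝ) < a + 1 + i := by
        have := Nat.cast_nonneg (α := ℝ) i
        linarith
      exact_mod_cast this.ne'
    simp only [eval_add, eval_sub, eval_mul, eval_one, eval_pow, eval_X, eval_natCast, rC, eval_C,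
      eval_ofNat, hJ] at h ⊢
    push_cast at h
    field_simp
    linear_combination (-1 : ℂ) * h

lemma jacobiOp_map_conj (p : ℂ[X]) :
    jacobiOp a b (p.map (starRingEnd ℂ)) = (jacobiOp a b p).map (starRingEnd ℂ) := by
  simp only [jacobiOp, rC, derivative_map, Polynomial.map_add, Polynomial.map_sub,
    Polynomial.map_mul, Polynomial.map_one, Polynomial.map_pow, Polynomial.map_X, Polynomial.map_C,
    Complex.conj_ofReal]

/-- Symmetry of `δ`: the difference of the integrands is the Pearson expression of `T = (1-x²)(p'q -
pq')`. -/
lemma jacobiInt_jacobiOp_symm {α β : ℝ} (hα : -1 < α) (hβ : -1 < β) (p q : ℂ[X]) :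
    jacobiInt hα hβ ((1 - X ^ 2) * (jacobiOp (α + 1) (β + 1) p * q))
      = jacobiInt hα hβ ((1 - X ^ 2) * (p * jacobiOp (α + 1) (β + 1) q)) := by
  rw [← sub_eq_zero, ← map_sub,
    ← jacobiInt_pearson hα hβ ((1 - X ^ 2) * (derivative p * q - p * derivative q))]
  congr 1
  simp only [jacobiOp, derivative_sub, derivative_mul, derivative_one, derivative_X_sq, rC_add,
    rC_sub, rC_one, map_ofNat]
  ring

lemma jacobiInt_jacobiP_ne {α β : ℝ} (hα : -1 < α) (hβ : -1 < β) {m n : ℕ} (h : n ≠ m) :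
    jacobiInt hα hβ ((1 - X ^ 2) * (jacobiP (α + 1) (β + 1) n
      * (jacobiP (α + 1) (β + 1) m).map (starRingEnd ℂ))) = 0 := by
  have ha : -1 < α + 1 := by linarith
  have hb : -1 < β + 1 := by linarith
  have h1 := jacobiInt_jacobiOp_symm hα hβ (jacobiP (α + 1) (β + 1) n)
    ((jacobiP (α + 1) (β + 1) m).map (starRingEnd ℂ))
  have hconj : (starRingEnd ℂ) (jacobiEig (α + 1) (β + 1) m) = jacobiEig (α + 1) (β + 1) m := by
    simp [jacobiEig]
  rw [jacobiOp_map_conj, jacobiOp_jacobiP ha, jacobiOp_jacobiP ha, Polynomial.map_mul,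
    Polynomial.map_C, hconj, mul_assoc, mul_left_comm _ (C _), mul_left_comm _ (C _),
    mul_left_comm _ (C _), ← smul_eq_C_mul, ← smul_eq_C_mul, map_smul, map_smul, ← sub_eq_zero,
    ← sub_smul, smul_eq_zero, sub_eq_zero] at h1
  exact h1.resolve_left fun h2 => h (jacobiEig_injective ha hb h2)

end JacobiPolynomials

/-! ### Calculus of matrix eigenvalues -/

section Eigen

variable {N : ℕ}

/-- `P · D = Λ P`. -/
def HasEig (P : MatPoly N) (D : RightOp N) (Λ : Matrix (Fin N) (Fin N) ℂ) : Prop :=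
  act P D = Λ.map C * P

lemma HasEig.isEigen {P : MatPoly N} {D : RightOp N} {Λ : Matrix (Fin N) (Fin N) ℂ}
    (h : HasEig P D Λ) : IsEigen P D := ⟨Λ, h⟩

lemma HasEig.mul {P : MatPoly N} {D E : RightOp N} {Λ Γ : Matrix (Fin N) (Fin N) ℂ}
    (hD : HasEig P D Λ) (hE : HasEig P E Γ) (h : IsDiffOp E) : HasEig P (D * E) (Λ * Γ) := by
  unfold HasEig at *
  rw [act_mul, hD, act_const_mul h, hE, ← mul_assoc, Matrix.map_mul]

lemma HasEig.add {P : MatPoly N} {D E : RightOp N} {Λ Γ : Matrix (Fin N) (Fin N) ℂ}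
    (hD : HasEig P D Λ) (hE : HasEig P E Γ) : HasEig P (D + E) (Λ + Γ) := by
  unfold HasEig at *
  rw [act_add, hD, hE, Matrix.map_add _ (map_add C), add_mul]

lemma HasEig.sub {P : MatPoly N} {D E : RightOp N} {Λ Γ : Matrix (Fin N) (Fin N) ℂ}
    (hD : HasEig P D Λ) (hE : HasEig P E Γ) : HasEig P (D - E) (Λ - Γ) := by
  unfold HasEig at *
  rw [act_sub, hD, hE, Matrix.map_sub _ (map_sub C), sub_mul]

lemma map_C_smul (c : ℂ) (Λ : Matrix (Fin N) (Fin N) ℂ) :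
    (c • Λ).map C = c • (Λ.map C : MatPoly N) := by
  ext1 i j
  simp [Polynomial.smul_eq_C_mul]

lemma HasEig.smul {P : MatPoly N} {D : RightOp N} {Λ : Matrix (Fin N) (Fin N) ℂ} (c : ℂ)
    (hD : HasEig P D Λ) : HasEig P (c • D) (c • Λ) := by
  unfold HasEig at *
  rw [act_smul, hD, map_C_smul, smul_mul_assoc]

lemma HasEig.one (P : MatPoly N) : HasEig P (1 : RightOp N) 1 := by
  unfold HasEig
  rw [act_one, Matrix.map_one _ C_0 C_1, one_mul]

lemma HasEig.pow {P : MatPoly N} {D : RightOp N} {Λ : Matrix (Fin N) (Fin N) ℂ}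
    (hD : HasEig P D Λ) (h : IsDiffOp D) (k : ℕ) : HasEig P (D ^ k) (Λ ^ k) := by
  induction k with
  | zero => simpa using HasEig.one P
  | succ k ih =>
    rw [pow_succ, pow_succ]
    exact ih.mul hD h

lemma HasEig.coef_const (p : ℂ[X]) (G : Matrix (Fin N) (Fin N) ℂ) :
    HasEig (p • (1 : MatPoly N)) (coef (G.map C)) G := by
  unfold HasEig
  rw [act_coef, smul_mul_assoc, one_mul, mul_smul_comm, mul_one]

lemma HasEig.aeval {P : MatPoly N} {D : RightOp N} {c : ℂ} (hD : HasEig P D (c • 1))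
    (h : IsDiffOp D) (p : ℂ[X]) : HasEig P (Polynomial.aeval D p) (p.eval c • 1) := by
  induction p using Polynomial.induction_on' with
  | add p q hp hq =>
    rw [map_add, eval_add, add_smul]
    exact hp.add hq
  | monomial n a =>
    rw [aeval_monomial, eval_monomial, ← Algebra.smul_def]
    have := (hD.pow h n).smul a
    rwa [_root_.smul_pow, one_pow, smul_smul] at this

lemma HasEig.eq {P : MatPoly N} {D E : RightOp N} {Λ : Matrix (Fin N) (Fin N) ℂ}
    (hD : HasEig P D Λ) (hE : HasEig P E Λ) : act P D = act P E := by
  unfold HasEig at *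
  rw [hD, hE]

lemma hasEig_smul_one_iff {P : MatPoly N} {D : RightOp N} {c : ℂ} :
    HasEig P D (c • 1) ↔ act P D = c • P := by
  rw [HasEig, map_C_smul_one, smul_mul_assoc, one_mul]

lemma isDiffOp_coef (F : MatPoly N) : IsDiffOp (coef F) := by
  simpa using isDiffOp_monomial 0 F

lemma isDiffOp_del_mul_coef (F : MatPoly N) : IsDiffOp (del N * coef F) := by
  simpa using isDiffOp_monomial 1 F

lemma IsDiffOp.sub {D E : RightOp N} (hD : IsDiffOp D) (hE : IsDiffOp E) : IsDiffOp (D - E) :=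
  (diffOpAlgebra N).sub_mem hD hE

lemma IsDiffOp.smul {D : RightOp N} (hD : IsDiffOp D) (c : ℂ) : IsDiffOp (c • D) :=
  (diffOpAlgebra N).smul_mem hD c

lemma IsDiffOp.pow {D : RightOp N} (hD : IsDiffOp D) (k : ℕ) : IsDiffOp (D ^ k) :=
  (diffOpAlgebra N).pow_mem hD k

lemma IsDiffOp.one : IsDiffOp (1 : RightOp N) := (diffOpAlgebra N).one_mem

lemma IsDiffOp.aeval {D : RightOp N} (hD : IsDiffOp D) (p : ℂ[X]) :
    IsDiffOp (Polynomial.aeval D p) := by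
  have h : Polynomial.aeval D p
      = ((Polynomial.aeval (⟨D, hD⟩ : diffOpAlgebra N) p : diffOpAlgebra N) : RightOp N) := by
    rw [Polynomial.aeval_subalgebra_coe]
  rw [h]
  exact Subtype.prop _

end Eigen

/-! ### Derivatives of products and adjoints -/

section Derivation

variable {N : ℕ}

lemma derivEnd_mul (P Q : MatPoly N) :
    derivEnd N (P * Q) = derivEnd N P * Q + P * derivEnd N Q := by
  ext1 i j
  simp [derivEnd, Matrix.mul_apply, Finset.sum_add_distrib]

lemma derivEnd_conjT (P : MatPoly N) : derivEnd N (conjT P) = conjT (derivEnd N P) := by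
  ext1 i j
  simp [derivEnd, conjT, derivative_map]

end Derivation

/-! ### Coefficient identities relating `𝒱`, `𝒩` and the weight -/

section Coefficients

/-- The coefficient of `∂` in `𝒱`. -/
def coefV₁ (α β v : ℝ) : MatPoly 2 :=
  !![X + rC ((β - α) / v), rC (1 + (β - α) / v); rC (1 + (α - β) / v), X + rC ((α - β) / v)]

/-- The coefficient of order zero in `𝒱`. -/
def coefV₀ (α β v : ℝ) : MatPoly 2 :=
  !![rC ((v + 2 + α + β) / 2), 0; 0, rC ((-v + 2 + α + β) / 2)]

/-- The coefficient of `∂` in `𝒩`. -/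
def coefN₁ (α β v : ℝ) : MatPoly 2 :=
  !![-X + rC ((β - α) / v), rC (1 + (β - α) / v); rC (1 + (α - β) / v), -X + rC ((α - β) / v)]

/-- The coefficient of order zero in `𝒩`. -/
def coefN₀ (α β v : ℝ) : MatPoly 2 :=
  !![rC (-(1 / 2) * (-v + 4 + α + β)), 0; 0, rC (-(1 / 2) * (α + β + v + 4))]

/-- The constant matrix relating the formal adjoint of `𝒱` to `𝒩`. -/
def adjS (α β v : ℝ) : Matrix (Fin 2) (Fin 2) ℂ :=
  !![((-(v * (v + 2 + α + β)) / (4 * (v + α - β)) : ℝ) : ℂ), 0;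
     0, ((-(v * (-v + 2 + α + β)) / (4 * (v - α + β)) : ℝ) : ℂ)]

/-- The boundary matrix in the integration by parts for `𝒱`. -/
def adjU (α β v : ℝ) : MatPoly 2 := -((adjS α β v).map C * conjT (coefN₁ α β v))

lemma opV_eq (α β v : ℝ) : opV α β v = del 2 * coef (coefV₁ α β v) + coef (coefV₀ α β v) := rfl

lemma opN_eq (α β v : ℝ) : opN α β v = del 2 * coef (coefN₁ α β v) + coef (coefN₀ α β v) := rfl

variable {α β v : ℝ}

/-- The two factors are `x + M` and `-x + M` for one constant matrix `M` with `M² = 1`. -/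
lemma coefV₁_mul_coefN₁ (hv : v ≠ 0) :
    coefV₁ α β v * coefN₁ α β v = (1 - X ^ 2 : ℂ[X]) • (1 : MatPoly 2) := by
  have hv' : (v : ℂ) ≠ 0 := by exact_mod_cast hv
  ext1 i j
  fin_cases i <;> fin_cases j <;> refine Polynomial.funext fun x => ?_ <;>
    simp [coefV₁, coefN₁, rC] <;> field_simp <;> ring

lemma coefN₁_mul_coefV₁ (hv : v ≠ 0) :
    coefN₁ α β v * coefV₁ α β v = (1 - X ^ 2 : ℂ[X]) • (1 : MatPoly 2) := by
  have hv' : (v : ℂ) ≠ 0 := by exact_mod_cast hv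
  ext1 i j
  fin_cases i <;> fin_cases j <;> refine Polynomial.funext fun x => ?_ <;>
    simp [coefV₁, coefN₁, rC] <;> field_simp <;> ring

lemma derivEnd_coefV₁ : derivEnd 2 (coefV₁ α β v) = 1 := by
  ext1 i j
  fin_cases i <;> fin_cases j <;> simp [derivEnd, coefV₁, rC]

lemma derivEnd_coefV₀ : derivEnd 2 (coefV₀ α β v) = 0 := by
  ext1 i j
  fin_cases i <;> fin_cases j <;> simp [derivEnd, coefV₀, rC]

lemma coef_VN_one (hv : v ≠ 0) :
    coefN₁ α β v + coefV₁ α β v * coefN₀ α β v + coefV₀ α β v * coefN₁ α β v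
      = (rC (β + 1 - (α + 1)) - X * rC (α + 1 + (β + 1) + 2)) • (1 : MatPoly 2) := by
  have hv' : (v : ℂ) ≠ 0 := by exact_mod_cast hv
  ext1 i j
  fin_cases i <;> fin_cases j <;> refine Polynomial.funext fun x => ?_ <;>
    simp [coefV₁, coefN₁, coefV₀, coefN₀, rC] <;> field_simp <;> ring

/-- The constants subtracted from `δ` in `𝒜`. -/
def cA₁ (α β v : ℝ) : ℝ := 1 / 4 * (α + β + v + 4) * (-v + 2 + α + β)

/-- The constants subtracted from `δ` in `𝒜`. -/
def cA₂ (α β v : ℝ) : ℝ := 1 / 4 * (-v + 4 + α + β) * (v + 2 + α + β)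

lemma coef_VN_zero : coefV₀ α β v * coefN₀ α β v
    = -((!![(cA₂ α β v : ℂ), 0; 0, (cA₁ α β v : ℂ)] : Matrix (Fin 2) (Fin 2) ℂ).map C) := by
  ext1 i j
  fin_cases i <;> fin_cases j <;> refine Polynomial.funext fun x => ?_ <;>
    simp [coefV₀, coefN₀, rC, cA₁, cA₂] <;> ring

lemma coef_neg {N : ℕ} (F : MatPoly N) : coef (-F) = -coef F := by
  rw [eq_neg_iff_add_eq_zero, ← coef_add, neg_add_cancel, coef_zero]

/-- The Darboux factorization. The constants occur in the order opposite to that in `𝒜`, so that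
multiplying by `𝒜` yields the scalar operator `(δ - c₁)(δ - c₂)`. -/
lemma opV_mul_opN (hv : v ≠ 0) : opV α β v * opN α β v = jacobiDelta (α + 1) (β + 1)
    - coef ((!![(cA₂ α β v : ℂ), 0; 0, (cA₁ α β v : ℂ)] : Matrix (Fin 2) (Fin 2) ℂ).map C) := by
  have h1 : coef (coefV₁ α β v) * (del 2 * coef (coefN₁ α β v))
      = del 2 * coef (coefV₁ α β v * coefN₁ α β v) + coef (coefN₁ α β v) := by
    rw [← mul_assoc, coef_mul_del, derivEnd_coefV₁, add_mul, mul_assoc, ← coef_mul, ← coef_mul,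
      one_mul]
  have h2 : coef (coefV₀ α β v) * (del 2 * coef (coefN₁ α β v))
      = del 2 * coef (coefV₀ α β v * coefN₁ α β v) := by
    rw [← mul_assoc, coef_mul_del, derivEnd_coefV₀, coef_zero, add_zero, mul_assoc, ← coef_mul]
  rw [sub_eq_add_neg, ← coef_neg, ← coef_VN_zero, jacobiDelta, ← coef_VN_one hv,
    ← coefV₁_mul_coefN₁ hv, opV_eq, opN_eq, add_mul, mul_add, mul_add, mul_assoc, h1, h2,
    mul_assoc, ← coef_mul, ← coef_mul, coef_add, coef_add, pow_two]
  simp only [mul_add, mul_assoc]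
  abel

lemma opA_eq : opA α β v = jacobiDelta (α + 1) (β + 1)
    - coef ((!![(cA₁ α β v : ℂ), 0; 0, (cA₂ α β v : ℂ)] : Matrix (Fin 2) (Fin 2) ℂ).map C) := by
  rw [opA]
  congr 2
  ext1 i j
  fin_cases i <;> fin_cases j <;> simp [rC, cA₁, cA₂]

/-- The factor `1 - x²` cancels the boundary terms and passes from `W` to the diagonal weight. With
`coefV₀_mul_polyW`, this is what integration by parts needs. -/
lemma coefV₁_mul_polyW (hv : v ≠ 0) (h₁ : v + α - β ≠ 0) (h₂ : v - α + β ≠ 0) :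
    coefV₁ α β v * polyW α β v = (1 - X ^ 2 : ℂ[X]) • adjU α β v := by
  have hv' : (v : ℂ) ≠ 0 := by exact_mod_cast hv
  have h₁' : (v + α - β : ℂ) ≠ 0 := by exact_mod_cast h₁
  have h₂' : (v - α + β : ℂ) ≠ 0 := by exact_mod_cast h₂
  ext1 i j
  fin_cases i <;> fin_cases j <;> refine Polynomial.funext fun x => ?_ <;>
    simp [coefV₁, coefN₁, polyW, adjU, adjS, conjT, rC, Matrix.mul_apply] <;> field_simp <;> ring

lemma coefV₀_mul_polyW (hv : v ≠ 0) (h₁ : v + α - β ≠ 0) (h₂ : v - α + β ≠ 0) :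
    coefV₀ α β v * polyW α β v = (rC (β - α) - X * rC (α + β + 2)) • adjU α β v
      + (1 - X ^ 2 : ℂ[X]) • derivEnd 2 (adjU α β v)
      + (1 - X ^ 2 : ℂ[X]) • ((adjS α β v).map C * conjT (coefN₀ α β v)) := by
  have hv' : (v : ℂ) ≠ 0 := by exact_mod_cast hv
  have h₁' : (v + α - β : ℂ) ≠ 0 := by exact_mod_cast h₁
  have h₂' : (v - α + β : ℂ) ≠ 0 := by exact_mod_cast h₂
  ext1 i j
  fin_cases i <;> fin_cases j <;> refine Polynomial.funext fun x => ?_ <;>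
    simp [coefV₀, coefN₀, coefN₁, polyW, adjU, adjS, conjT, rC, Matrix.mul_apply, map_ofNat, derivEnd]
      <;> field_simp <;> ring

end Coefficients

/-! ### Consequences of the parameter inequalities -/

section Parameters

variable {α β v : ℝ}

lemma neg_one_lt_left (hv₁ : |α - β| < |v|) (hv₂ : |v| < α + β + 2) : -1 < α := by
  have := neg_abs_le (α - β)
  linarith

lemma neg_one_lt_right (hv₁ : |α - β| < |v|) (hv₂ : |v| < α + β + 2) : -1 < β := by
  have := le_abs_self (α - β)
  linarith

lemma param_ne_zero (hv₁ : |α - β| < |v|) : v ≠ 0 :=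
  abs_pos.mp ((abs_nonneg _).trans_lt hv₁)

lemma param_add_sub_ne_zero (hv₁ : |α - β| < |v|) : v + α - β ≠ 0 := by
  intro h
  have : v = -(α - β) := by linarith
  rw [this, abs_neg] at hv₁
  exact lt_irrefl _ hv₁

lemma param_sub_add_ne_zero (hv₁ : |α - β| < |v|) : v - α + β ≠ 0 := by
  intro h
  have : v = α - β := by linarith
  rw [this] at hv₁
  exact lt_irrefl _ hv₁

lemma param_pos (hv₂ : |v| < α + β + 2) : 0 < v + 2 + α + β := by
  have := neg_abs_le v
  linarith

lemma param_pos' (hv₂ : |v| < α + β + 2) : 0 < -v + 2 + α + β := by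
  have := le_abs_self v
  linarith

lemma cA₁_pos (hv₂ : |v| < α + β + 2) : 0 < cA₁ α β v := by
  have h1 := param_pos hv₂
  have h2 := param_pos' hv₂
  exact mul_pos (mul_pos (by norm_num) (by linarith)) h2

lemma cA₂_pos (hv₂ : |v| < α + β + 2) : 0 < cA₂ α β v := by
  have h1 := param_pos hv₂
  have h2 := param_pos' hv₂
  exact mul_pos (mul_pos (by norm_num) (by linarith)) h1

lemma cA₂_sub_cA₁ : cA₂ α β v - cA₁ α β v = v := by
  simp only [cA₁, cA₂]
  ring

end Parameters

/-! ### The sequences `R_n` and `Q_n` and their eigenvalues -/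

section Sequences

variable {α β v : ℝ}

/-- The orthogonal polynomials for the diagonal weight. -/
def seqR (α β : ℝ) (n : ℕ) : MatPoly 2 := jacobiP (α + 1) (β + 1) n • (1 : MatPoly 2)

/-- The orthogonal polynomials for the weight `W`. -/
def seqQ (α β v : ℝ) (n : ℕ) : MatPoly 2 := act (seqR α β n) (opV α β v)

/-- The eigenvalues of `δ` on the orthogonal polynomials for the diagonal weight. -/
def eigR (α β : ℝ) (n : ℕ) : ℂ := jacobiEig (α + 1) (β + 1) n

/-- The eigenvalues of `𝒱 𝒩`. -/
def eigVN (α β v : ℝ) (n : ℕ) : Matrix (Fin 2) (Fin 2) ℂ :=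
  !![eigR α β n - cA₂ α β v, 0; 0, eigR α β n - cA₁ α β v]

/-- The eigenvalues of `𝒜`. -/
def eigA (α β v : ℝ) (n : ℕ) : Matrix (Fin 2) (Fin 2) ℂ :=
  !![eigR α β n - cA₁ α β v, 0; 0, eigR α β n - cA₂ α β v]

lemma isDiffOp_opV : IsDiffOp (opV α β v) :=
  (isDiffOp_del_mul_coef _).add (isDiffOp_coef _)

lemma isDiffOp_opN : IsDiffOp (opN α β v) :=
  (isDiffOp_del_mul_coef _).add (isDiffOp_coef _)

lemma isDiffOp_jacobiDelta (a b : ℝ) : IsDiffOp (jacobiDelta a b) :=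
  (isDiffOp_monomial _ _).add (isDiffOp_del_mul_coef _)

lemma isDiffOp_opA : IsDiffOp (opA α β v) :=
  (isDiffOp_jacobiDelta _ _).sub (isDiffOp_coef _)

lemma act_jacobiDelta (a b : ℝ) (p : ℂ[X]) :
    act (p • (1 : MatPoly 2)) (jacobiDelta a b) = jacobiOp a b p • (1 : MatPoly 2) := by
  rw [jacobiDelta, act_add, act_mul, act_mul, act_del_pow, act_del, derivEnd_pow_smul_one,
    derivEnd_smul_one, act_coef, act_coef, smul_mul_smul_comm, smul_mul_smul_comm, mul_one,
    ← add_smul, jacobiOp]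
  congr 1
  simp only [Function.iterate_succ_apply, Function.iterate_zero_apply]
  ring

lemma hasEig_delta (hα : -1 < α) (n : ℕ) :
    HasEig (seqR α β n) (jacobiDelta (α + 1) (β + 1)) (eigR α β n • 1) := by
  rw [hasEig_smul_one_iff, seqR, act_jacobiDelta, jacobiOp_jacobiP (by linarith), eigR,
    ← smul_eq_C_mul, smul_assoc]

lemma hasEig_VN (hα : -1 < α) (hv : v ≠ 0) (n : ℕ) :
    HasEig (seqR α β n) (opV α β v * opN α β v) (eigVN α β v n) := by
  have h := (hasEig_delta (β := β) hα n).sub (HasEig.coef_const (jacobiP (α + 1) (β + 1) n)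
    !![(cA₂ α β v : ℂ), 0; 0, (cA₁ α β v : ℂ)])
  rw [opV_mul_opN hv]
  convert h using 1
  ext i j
  fin_cases i <;> fin_cases j <;> simp [eigVN]

lemma hasEig_A (hα : -1 < α) (n : ℕ) :
    HasEig (seqR α β n) (opA α β v) (eigA α β v n) := by
  have h := (hasEig_delta (β := β) hα n).sub (HasEig.coef_const (jacobiP (α + 1) (β + 1) n)
    !![(cA₁ α β v : ℂ), 0; 0, (cA₂ α β v : ℂ)])
  rw [opA_eq]
  convert h using 1
  ext i j
  fin_cases i <;> fin_cases j <;> simp [eigA]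

/-- Since `Q_n · 𝒩 = R_n · 𝒱𝒩`, applying `𝒩` returns to a constant multiple of `R_n`; then `T` acts
and `𝒱` leads back to `Q_n`. -/
lemma hasEig_NTV (hα : -1 < α) (hv : v ≠ 0) {n : ℕ} {T : RightOp 2}
    {Λ : Matrix (Fin 2) (Fin 2) ℂ} (hT : IsDiffOp T) (h : HasEig (seqR α β n) T Λ) :
    HasEig (seqQ α β v n) (opN α β v * T * opV α β v) (eigVN α β v n * Λ) := by
  have h1 := (hasEig_VN (β := β) hα hv n).mul h hT
  unfold HasEig at h1 ⊢
  rw [seqQ, ← act_mul, ← mul_assoc, ← mul_assoc, act_mul, h1, act_const_mul isDiffOp_opV]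

lemma act_seqR_opV (p : ℂ[X]) : act (p • (1 : MatPoly 2)) (opV α β v)
    = derivative p • coefV₁ α β v + p • coefV₀ α β v := by
  rw [opV_eq, act_add, act_mul, act_del, derivEnd_smul_one, act_coef, act_coef, smul_mul_assoc,
    smul_mul_assoc, one_mul, one_mul]

lemma isRegular_seqR (hα : -1 < α) (hβ : -1 < β) (n : ℕ) :
    IsRegularOfDegree (seqR α β n) n := by
  constructor
  · intro i j
    by_cases h : i = j
    · simpa [seqR, h] using natDegree_jacobiP_le n
    · simp [seqR, h]
  · have : ((seqR α β n).map fun p => p.coeff n)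
        = (jacobiP (α + 1) (β + 1) n).coeff n • (1 : Matrix (Fin 2) (Fin 2) ℂ) := by
      ext i j
      by_cases h : i = j <;> simp [seqR, h]
    rw [this, Matrix.isUnit_iff_isUnit_det, Matrix.det_smul, Matrix.det_one, mul_one]
    exact (pow_ne_zero _ (coeff_jacobiP_ne_zero (by linarith) (by linarith) n)).isUnit

/-- The off-diagonal entries of `𝒱` do not reach degree `n`; the diagonal leading terms carry the
factors `n + (±v+2+α+β)/2`, positive because `|v| < α+β+2`. -/
lemma isRegular_seqQ (hv₁ : |α - β| < |v|) (hv₂ : |v| < α + β + 2) (n : ℕ) :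
    IsRegularOfDegree (seqQ α β v n) n := by
  have hα := neg_one_lt_left hv₁ hv₂
  have hβ := neg_one_lt_right hv₁ hv₂
  have hc := coeff_jacobiP_ne_zero (a := α + 1) (b := β + 1) (by linarith) (by linarith) n
  have hd := natDegree_jacobiP_le (a := α + 1) (b := β + 1) n
  set p := jacobiP (α + 1) (β + 1) n with hp
  have hQ : seqQ α β v n = derivative p • coefV₁ α β v + p • coefV₀ α β v := act_seqR_opV p
  have hd' : (derivative p).natDegree ≤ n - 1 := (natDegree_derivative_le p).trans (by omega)
  have hcC : ∀ r : ℝ, (derivative p * rC r).coeff n = 0 := by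
    intro r
    rw [rC, mul_comm, coeff_C_mul]
    rcases Nat.eq_zero_or_pos n with h0 | h0
    · have : p.natDegree = 0 := by omega
      rw [derivative_of_natDegree_zero this]
      simp
    · rw [coeff_eq_zero_of_natDegree_lt (by omega), mul_zero]
  have hcX : (derivative p * X).coeff n = n * p.coeff n := by
    cases n with
    | zero => simp
    | succ n =>
      rw [coeff_mul_X, coeff_derivative]
      push_cast
      ring
  have hcK : ∀ r : ℝ, (p * rC r).coeff n = p.coeff n * r := by
    intro r
    rw [rC, mul_comm, coeff_C_mul, mul_comm]
  constructor
  · intro i j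
    rw [hQ, Matrix.add_apply, Matrix.smul_apply, Matrix.smul_apply, smul_eq_mul, smul_eq_mul]
    have hq : (coefV₁ α β v i j).natDegree ≤ 1 := by
      fin_cases i <;> fin_cases j <;> simp [coefV₁, rC]
    have hs : (coefV₀ α β v i j).natDegree ≤ 0 := by
      fin_cases i <;> fin_cases j <;> simp [coefV₀, rC, -Complex.ofReal_div, -Complex.ofReal_add]
    refine natDegree_add_le_of_degree_le ?_ ?_
    · rcases Nat.eq_zero_or_pos n with h0 | h0
      · have : p.natDegree = 0 := by omega
        rw [derivative_of_natDegree_zero this]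
        simp
      · exact natDegree_mul_le.trans (by omega)
    · exact natDegree_mul_le.trans (by omega)
  · have hmat : ((seqQ α β v n).map fun q => q.coeff n)
        = Matrix.diagonal ![p.coeff n * (n + ((v + 2 + α + β) / 2 : ℝ)),
            p.coeff n * (n + ((-v + 2 + α + β) / 2 : ℝ))] := by
      rw [hQ]
      ext i j
      fin_cases i <;> fin_cases j <;>
        simp [coefV₁, coefV₀, mul_add, hcC, hcX, hcK, -Complex.ofReal_div, -Complex.ofReal_add] <;>
        ring
    rw [hmat, Matrix.isUnit_iff_isUnit_det, Matrix.det_diagonal, Fin.prod_univ_two]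
    have hn := Nat.cast_nonneg (α := ℝ) n
    have h1 : (0 : ℝ) < n + (v + 2 + α + β) / 2 := by linarith [param_pos hv₂]
    have h2 : (0 : ℝ) < n + (-v + 2 + α + β) / 2 := by linarith [param_pos' hv₂]
    refine (mul_ne_zero (mul_ne_zero hc ?_) (mul_ne_zero hc ?_)).isUnit
    · exact_mod_cast h1.ne'
    · exact_mod_cast h2.ne'

end Sequences

/-! ### Adjointness of `𝒱` and `𝒩`, and orthogonality of the `Q_n` -/

section Adjoint

variable {α β v : ℝ}

lemma map_matrix_eq_of_sub (L : ℂ[X] →ₗ[ℂ] ℂ) (A B : MatPoly 2)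
    (h : ∀ i j, L (A i j - B i j) = 0) : A.map L = B.map L := by
  ext i j
  simpa [sub_eq_zero] using h i j

lemma adjS_mul_conjT_coefN₁ :
    (adjS α β v).map C * conjT (coefN₁ α β v) = -adjU α β v := by
  rw [adjU, neg_neg]

lemma adjS_conjTranspose : (adjS α β v).conjTranspose = adjS α β v := by
  ext i j
  fin_cases i <;> fin_cases j <;> simp [adjS, Complex.conj_ofReal]

/-- The formal adjoint of `𝒱` is `𝒩` up to a constant. -/
lemma form_opV (hv₁ : |α - β| < |v|) (hv₂ : |v| < α + β + 2) (P Q : MatPoly 2) :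
    form (Set.Ioo (-1) 1) (jacobiW α β v) (act P (opV α β v)) Q
      = form (Set.Ioo (-1) 1) (jacobiWt α β) P (act Q (opN α β v) * (adjS α β v).map C) := by
  have hα := neg_one_lt_left hv₁ hv₂
  have hβ := neg_one_lt_right hv₁ hv₂
  have hv := param_ne_zero hv₁
  have h₁ := param_add_sub_ne_zero hv₁
  have h₂ := param_sub_add_ne_zero hv₁
  rw [isPolyForm_jacobiW hα hβ, isPolyForm_jacobiWt hα hβ]
  have hN : conjT (act Q (opN α β v) * (adjS α β v).map C)
      = -(adjU α β v * derivEnd 2 (conjT Q))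
        + (adjS α β v).map C * conjT (coefN₀ α β v) * conjT Q := by
    rw [opN_eq, act_add, act_mul, act_del, act_coef, act_coef, conjT_mul, conjT_const,
      adjS_conjTranspose, conjT_add, conjT_mul, conjT_mul, mul_add, ← mul_assoc, ← mul_assoc,
      adjS_mul_conjT_coefN₁, derivEnd_conjT, neg_mul]
  have hVW : act P (opV α β v) * polyW α β v * conjT Q
      = (1 - X ^ 2 : ℂ[X]) • (derivEnd 2 P * adjU α β v * conjT Q)
        + (rC (β - α) - X * rC (α + β + 2)) • (P * adjU α β v * conjT Q)
        + (1 - X ^ 2 : ℂ[X]) • (P * derivEnd 2 (adjU α β v) * conjT Q)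
        + (1 - X ^ 2 : ℂ[X]) • (P * ((adjS α β v).map C * conjT (coefN₀ α β v)) * conjT Q) := by
    rw [opV_eq, act_add, act_mul, act_del, act_coef, act_coef, add_mul, mul_assoc, mul_assoc P,
      coefV₁_mul_polyW hv h₁ h₂, coefV₀_mul_polyW hv h₁ h₂]
    simp only [mul_add, add_mul, mul_smul_comm, smul_mul_assoc]
    abel
  rw [hN, hVW]
  refine map_matrix_eq_of_sub _ _ _ fun i j => ?_
  -- Entrywise, the two integrands differ by the Pearson expression of `P U Q^*`, with `U` the
  -- boundary matrix `adjU`.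
  rw [← jacobiInt_pearson hα hβ ((P * adjU α β v * conjT Q) i j)]
  congr 1
  have hT : derivative ((P * adjU α β v * conjT Q) i j)
      = derivEnd 2 (P * adjU α β v * conjT Q) i j := rfl
  rw [hT, derivEnd_mul, derivEnd_mul]
  simp only [mul_smul_comm, smul_mul_assoc, mul_add, add_mul, mul_one, mul_neg, mul_assoc,
    Matrix.add_apply, Matrix.smul_apply, Matrix.neg_apply, smul_eq_mul]
  ring

lemma form_seqR (hα : -1 < α) (hβ : -1 < β) (n m : ℕ) :
    form (Set.Ioo (-1) 1) (jacobiWt α β) (seqR α β n) (seqR α β m)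
      = jacobiInt hα hβ ((1 - X ^ 2) * (jacobiP (α + 1) (β + 1) n
          * (jacobiP (α + 1) (β + 1) m).map (starRingEnd ℂ))) • 1 := by
  rw [isPolyForm_jacobiWt hα hβ]
  have h : conjT (seqR α β m) = (jacobiP (α + 1) (β + 1) m).map (starRingEnd ℂ) • 1 := by
    ext1 i j
    by_cases h : i = j
    · simp [conjT, seqR, h]
    · simp [conjT, seqR, h, Ne.symm h]
  rw [h, seqR, smul_mul_smul_comm, smul_mul_smul_comm, mul_one, mul_one]
  ext i j
  by_cases h : i = j
  · simp only [h, Matrix.map_apply, Matrix.smul_apply, Matrix.one_apply_eq, smul_eq_mul, mul_one]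
    congr 1
    ring
  · simp [h]

lemma isOrthogonalSeq_seqR (hα : -1 < α) (hβ : -1 < β) :
    IsOrthogonalSeq (Set.Ioo (-1) 1) (jacobiWt α β) (seqR α β) :=
  ⟨isRegular_seqR hα hβ, fun n m h => by
    rw [form_seqR hα hβ, jacobiInt_jacobiP_ne hα hβ h, zero_smul]⟩

lemma isUnit_form_seqR (hα : -1 < α) (hβ : -1 < β) (n : ℕ) :
    IsUnit (form (Set.Ioo (-1) 1) (jacobiWt α β) (seqR α β n) (seqR α β n)) := by
  rw [form_seqR hα hβ, Matrix.isUnit_iff_isUnit_det, Matrix.det_smul, Matrix.det_one, mul_one]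
  exact (pow_ne_zero _ (jacobiInt_mul_conj_ne_zero hα hβ (jacobiP_ne_zero n))).isUnit

/-- Moving the left `𝒱` across the form makes `𝒱𝒩` act on `R_m`, so norms and orthogonality come
from the diagonal weight. -/
lemma form_seqQ (hv₁ : |α - β| < |v|) (hv₂ : |v| < α + β + 2) (n m : ℕ) :
    form (Set.Ioo (-1) 1) (jacobiW α β v) (seqQ α β v n) (seqQ α β v m)
      = form (Set.Ioo (-1) 1) (jacobiWt α β) (seqR α β n) (seqR α β m)
        * (eigVN α β v m * adjS α β v).conjTranspose := by
  have hα := neg_one_lt_left hv₁ hv₂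
  have hβ := neg_one_lt_right hv₁ hv₂
  rw [← (isPolyForm_jacobiWt hα hβ).const_mul_right, seqQ, form_opV hv₁ hv₂, seqQ, ← act_mul,
    hasEig_VN hα (param_ne_zero hv₁) m]
  congr 1
  rw [Matrix.map_mul, mul_assoc, mul_assoc]
  congr 1
  rw [seqR, smul_mul_assoc, one_mul, mul_smul_comm, mul_one]

lemma eigR_nonpos (hα : -1 < α) (hβ : -1 < β) (n : ℕ) : ∃ r : ℝ, r ≤ 0 ∧ eigR α β n = r := by
  refine ⟨-((n : ℝ) * (n + (α + 1) + (β + 1) + 1)), ?_, ?_⟩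
  · have hn := Nat.cast_nonneg (α := ℝ) n
    have : 0 ≤ (n : ℝ) * (n + (α + 1) + (β + 1) + 1) := mul_nonneg hn (by linarith)
    linarith
  · simp [eigR, jacobiEig]

lemma eigR_sub_ne_zero (hα : -1 < α) (hβ : -1 < β) (n : ℕ) {c : ℝ} (hc : 0 < c) :
    eigR α β n - c ≠ 0 := by
  obtain ⟨r, hr, h⟩ := eigR_nonpos hα hβ n
  rw [h, sub_ne_zero]
  exact_mod_cast (hr.trans_lt hc).ne

lemma det_eigVN_ne_zero (hv₁ : |α - β| < |v|) (hv₂ : |v| < α + β + 2) (n : ℕ) :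
    (eigVN α β v n).det ≠ 0 := by
  have hα := neg_one_lt_left hv₁ hv₂
  have hβ := neg_one_lt_right hv₁ hv₂
  rw [eigVN, Matrix.det_fin_two_of, mul_zero, sub_zero]
  exact mul_ne_zero (eigR_sub_ne_zero hα hβ n (cA₂_pos hv₂))
    (eigR_sub_ne_zero hα hβ n (cA₁_pos hv₂))

lemma det_adjS_ne_zero (hv₁ : |α - β| < |v|) (hv₂ : |v| < α + β + 2) :
    (adjS α β v).det ≠ 0 := by
  have hv := param_ne_zero hv₁
  rw [adjS, Matrix.det_fin_two_of, mul_zero, sub_zero, ← Complex.ofReal_mul,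
    Complex.ofReal_ne_zero]
  exact mul_ne_zero
    (div_ne_zero (neg_ne_zero.mpr (mul_ne_zero hv (param_pos hv₂).ne'))
      (mul_ne_zero (by norm_num) (param_add_sub_ne_zero hv₁)))
    (div_ne_zero (neg_ne_zero.mpr (mul_ne_zero hv (param_pos' hv₂).ne'))
      (mul_ne_zero (by norm_num) (param_sub_add_ne_zero hv₁)))

lemma isOrthogonalSeq_seqQ (hv₁ : |α - β| < |v|) (hv₂ : |v| < α + β + 2) :
    IsOrthogonalSeq (Set.Ioo (-1) 1) (jacobiW α β v) (seqQ α β v) :=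
  ⟨isRegular_seqQ hv₁ hv₂, fun n m h => by
    rw [form_seqQ hv₁ hv₂, (isOrthogonalSeq_seqR (neg_one_lt_left hv₁ hv₂)
      (neg_one_lt_right hv₁ hv₂)).2 n m h, zero_mul]⟩

lemma isUnit_form_seqQ (hv₁ : |α - β| < |v|) (hv₂ : |v| < α + β + 2) (n : ℕ) :
    IsUnit (form (Set.Ioo (-1) 1) (jacobiW α β v) (seqQ α β v n) (seqQ α β v n)) := by
  rw [form_seqQ hv₁ hv₂]
  refine (isUnit_form_seqR (neg_one_lt_left hv₁ hv₂) (neg_one_lt_right hv₁ hv₂) n).mul ?_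
  rw [Matrix.isUnit_iff_isUnit_det, Matrix.det_conjTranspose, Matrix.det_mul]
  exact (star_ne_zero.mpr (mul_ne_zero (det_eigVN_ne_zero hv₁ hv₂ n)
    (det_adjS_ne_zero hv₁ hv₂))).isUnit

lemma mem_centerD_jacobiWt_iff (hα : -1 < α) (hβ : -1 < β) (D : RightOp 2) :
    D ∈ centerD (Set.Ioo (-1) 1) (jacobiWt α β)
      ↔ IsDiffOp D ∧ ∀ n, ∃ c : ℂ, act (seqR α β n) D = c • seqR α β n := by
  refine mem_centerD_iff (isPolyForm_jacobiWt hα hβ) (isOrthogonalSeq_seqR hα hβ)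
    (isUnit_form_seqR hα hβ) (fun n G => ⟨coef (G.map C), ?_, HasEig.coef_const _ G⟩) D
  rw [mem_algD_iff (isPolyForm_jacobiWt hα hβ) (isOrthogonalSeq_seqR hα hβ)
    (isUnit_form_seqR hα hβ)]
  exact ⟨isDiffOp_coef _, fun n => (HasEig.coef_const _ G).isEigen⟩

/-- For the richness hypothesis of `mem_centerD_iff`, insert the constant `Λ_n⁻¹ G` between `𝒩` and
`𝒱`, where `Λ_n` is the eigenvalue of `𝒱𝒩`; at degree `n` the result has eigenvalue `G`. -/
lemma mem_centerD_jacobiW_iff (hv₁ : |α - β| < |v|) (hv₂ : |v| < α + β + 2) (D : RightOp 2) :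
    D ∈ centerD (Set.Ioo (-1) 1) (jacobiW α β v)
      ↔ IsDiffOp D ∧ ∀ n, ∃ c : ℂ, act (seqQ α β v n) D = c • seqQ α β v n := by
  have hα := neg_one_lt_left hv₁ hv₂
  have hβ := neg_one_lt_right hv₁ hv₂
  have hW := isPolyForm_jacobiW hα hβ v
  have h₀ := isOrthogonalSeq_seqQ hv₁ hv₂
  have hu := isUnit_form_seqQ hv₁ hv₂
  refine mem_centerD_iff hW h₀ hu (fun n G => ?_) D
  have hE : ∀ k, HasEig (seqQ α β v k)
      (opN α β v * coef (((eigVN α β v n)⁻¹ * G).map C) * opV α β v)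
      (eigVN α β v k * ((eigVN α β v n)⁻¹ * G)) := fun k =>
    hasEig_NTV hα (param_ne_zero hv₁) (isDiffOp_coef _) (HasEig.coef_const _ _)
  refine ⟨opN α β v * coef (((eigVN α β v n)⁻¹ * G).map C) * opV α β v, ?_, ?_⟩
  · rw [mem_algD_iff hW h₀ hu]
    exact ⟨(isDiffOp_opN.mul (isDiffOp_coef _)).mul isDiffOp_opV, fun k => (hE k).isEigen⟩
  · have h := hE n
    rwa [← mul_assoc, Matrix.mul_nonsing_inv _ (det_eigVN_ne_zero hv₁ hv₂ n).isUnit,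
      one_mul] at h

end Adjoint

/-! ### Polynomial dependence of eigenvalues and exclusion of `δ` -/

section Rigidity

variable {α β v : ℝ}

lemma seqR_eval_one (n : ℕ) (i : Fin 2) : (seqR α β n i i).eval 1 = 1 := by
  simp [seqR, eval_one_jacobiP]

/-- The values at `x = 1` of the image of `R_n` under a differential operator are polynomials in the
eigenvalue. -/
lemma exists_eval_one_act (hα : -1 < α) {D : RightOp 2} (hD : IsDiffOp D) (i j : Fin 2) :
    ∃ H : ℂ[X], ∀ n, (act (seqR α β n) D i j).eval 1 = H.eval (eigR α β n) := by
  obtain ⟨m, F, rfl⟩ := hD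
  choose J hJ using fun k =>
    exists_iterate_derivative_jacobiP (a := α + 1) (b := β + 1) (by linarith) k
  refine ⟨∑ k ∈ Finset.range (m + 1), J k * C ((F k i j).eval 1), fun n => ?_⟩
  rw [seqR, act_smul_one_diffOp, Matrix.sum_apply, eval_finsetSum, eval_finsetSum]
  refine Finset.sum_congr rfl fun k _ => ?_
  rw [Matrix.smul_apply, smul_eq_mul, eval_mul, hJ, eval_mul, eval_C, eigR]

/-- As `p_n(1) = 1`, the scalar eigenvalue is read off at `x = 1` and is a polynomial `H` in `λ_n`;
then `D` and `H(δ)` agree on every `R_n`. -/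
lemma mem_centerD_jacobiWt_iff_aeval (hα : -1 < α) (hβ : -1 < β) (D : RightOp 2) :
    D ∈ centerD (Set.Ioo (-1) 1) (jacobiWt α β)
      ↔ ∃ q : ℂ[X], aeval (jacobiDelta (α + 1) (β + 1)) q = D := by
  rw [mem_centerD_jacobiWt_iff hα hβ]
  constructor
  · rintro ⟨hD, h⟩
    obtain ⟨H, hH⟩ := exists_eval_one_act (β := β) hα hD 0 0
    refine ⟨H, IsDiffOp.ext_of_regular (isRegular_seqR hα hβ)
      ((isDiffOp_jacobiDelta _ _).aeval H) hD fun n => ?_⟩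
    obtain ⟨c, hc⟩ := h n
    have h1 := hH n
    rw [hc, Matrix.smul_apply, eval_smul, seqR_eval_one, smul_eq_mul, mul_one] at h1
    rw [hc, h1]
    exact hasEig_smul_one_iff.mp ((hasEig_delta hα n).aeval (isDiffOp_jacobiDelta _ _) H)
  · rintro ⟨q, rfl⟩
    exact ⟨(isDiffOp_jacobiDelta _ _).aeval q, fun n => ⟨_, hasEig_smul_one_iff.mp
      ((hasEig_delta hα n).aeval (isDiffOp_jacobiDelta _ _) q)⟩⟩

/-- Scalar eigenvalues on the orthogonal polynomials for `W` are polynomials in the eigenvalue of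
`δ`. -/
lemma exists_poly_eigenvalue (hα : -1 < α) (hv₂ : |v| < α + β + 2) {D : RightOp 2}
    (hD : IsDiffOp D) (h : ∀ n, ∃ c : ℂ, act (seqQ α β v n) D = c • seqQ α β v n) :
    ∃ l : ℂ[X], ∀ n, act (seqQ α β v n) D = l.eval (eigR α β n) • seqQ α β v n := by
  have hVD : IsDiffOp (opV α β v * D) := isDiffOp_opV.mul hD
  obtain ⟨H₀, h₀⟩ := exists_eval_one_act (β := β) hα hVD 0 0
  obtain ⟨H₁, h₁⟩ := exists_eval_one_act (β := β) hα hVD 0 1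
  set k : ℂ := (((v + 2 + α + β) / 2 : ℝ) : ℂ) with hk
  have hk0 : k ≠ 0 := by
    have := param_pos hv₂
    exact Complex.ofReal_ne_zero.mpr (by linarith)
  refine ⟨C k⁻¹ * (H₀ - H₁), fun n => ?_⟩
  obtain ⟨c, hc⟩ := h n
  have hQ : seqQ α β v n = derivative (jacobiP (α + 1) (β + 1) n) • coefV₁ α β v
      + jacobiP (α + 1) (β + 1) n • coefV₀ α β v := act_seqR_opV _
  -- The first-row entries of `coefV₁` coincide at `x = 1`, so the terms with `p_n'(1)` cancel and a
  -- nonzero constant independent of `n` remains.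
  have hsub : (seqQ α β v n 0 0).eval 1 - (seqQ α β v n 0 1).eval 1 = k := by
    rw [hQ]
    simp [coefV₁, coefV₀, rC, eval_one_jacobiP, hk]
  have e₀ := h₀ n
  have e₁ := h₁ n
  rw [act_mul] at e₀ e₁
  change (act (seqQ α β v n) D 0 0).eval 1 = _ at e₀
  change (act (seqQ α β v n) D 0 1).eval 1 = _ at e₁
  rw [hc, Matrix.smul_apply, eval_smul, smul_eq_mul] at e₀ e₁
  have hcl : (C k⁻¹ * (H₀ - H₁)).eval (eigR α β n) = c := by
    rw [eval_mul, eval_sub, eval_C, ← e₀, ← e₁, ← mul_sub, hsub, mul_comm c, inv_mul_cancel_left₀ hk0]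
  rw [hcl, hc]

lemma del_mul_coefV₁_mul_del_pow (i : ℕ) : del 2 * coef (coefV₁ α β v) * del 2 ^ i
    = del 2 ^ (i + 1) * coef (coefV₁ α β v) + del 2 ^ i * coef ((i : ℂ[X]) • (1 : MatPoly 2)) := by
  have h1 : coef (1 : MatPoly 2) = 1 := by
    apply ext_act
    intro P
    rw [act_coef, mul_one, act_one]
  induction i with
  | zero => simp [coef_zero]
  | succ i ih =>
    have h2 : coef ((i : ℂ[X]) • (1 : MatPoly 2)) * del 2
        = del 2 * coef ((i : ℂ[X]) • (1 : MatPoly 2)) := by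
      rw [coef_mul_del, derivEnd_smul_one, derivative_natCast, zero_smul, coef_zero, add_zero]
    rw [pow_succ (del 2) i, ← mul_assoc, ih, add_mul, mul_assoc, mul_assoc _ _ (del 2), coef_mul_del,
      h2, derivEnd_coefV₁, Nat.cast_succ, add_smul, one_smul, coef_add, mul_add, mul_add]
    simp only [pow_succ, mul_assoc]
    abel

lemma coefV₀_mul_del_pow (i : ℕ) :
    coef (coefV₀ α β v) * del 2 ^ i = del 2 ^ i * coef (coefV₀ α β v) := by
  induction i with
  | zero => simp
  | succ i ih =>
    rw [pow_succ, ← mul_assoc, ih, mul_assoc, coef_mul_del, derivEnd_coefV₀, coef_zero, add_zero,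
      mul_assoc]

/-- The coefficients of `𝒱 D`. -/
def coefVD (α β v : ℝ) (F : ℕ → MatPoly 2) : ℕ → MatPoly 2
  | 0 => coefV₀ α β v * F 0
  | j + 1 => coefV₁ α β v * F j + (((j + 1 : ℕ) : ℂ[X]) • (1 : MatPoly 2) + coefV₀ α β v) * F (j + 1)

lemma opV_mul_diffOp (m : ℕ) (F : ℕ → MatPoly 2) (hF : F (m + 1) = 0) :
    opV α β v * diffOp m F = diffOp (m + 1) (coefVD α β v F) := by
  have h : ∀ i, opV α β v * (del 2 ^ i * coef (F i)) = del 2 ^ (i + 1) * coef (coefV₁ α β v * F i)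
      + del 2 ^ i * coef (((i : ℂ[X]) • (1 : MatPoly 2) + coefV₀ α β v) * F i) := by
    intro i
    rw [opV_eq, ← mul_assoc, add_mul, del_mul_coefV₁_mul_del_pow, coefV₀_mul_del_pow, coef_mul,
      coef_mul, coef_add]
    simp only [add_mul, mul_add, mul_assoc]
    abel
  -- Adding a zero top term aligns this sum with the one whose order is shifted up by `coefV₁`.
  have h2 : ∑ i ∈ Finset.range (m + 1),
      del 2 ^ i * coef (((i : ℂ[X]) • (1 : MatPoly 2) + coefV₀ α β v) * F i)
      = ∑ i ∈ Finset.range (m + 1 + 1),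
      del 2 ^ i * coef (((i : ℂ[X]) • (1 : MatPoly 2) + coefV₀ α β v) * F i) := by
    rw [Finset.sum_range_succ _ (m + 1), hF, mul_zero, coef_zero, mul_zero, add_zero]
  rw [diffOp, Finset.mul_sum, Finset.sum_congr rfl fun i _ => h i, Finset.sum_add_distrib, h2,
    Finset.sum_range_succ' _ (m + 1), ← add_assoc, ← Finset.sum_add_distrib, diffOp,
    Finset.sum_range_succ' _ (m + 1)]
  refine congrArg₂ (· + ·) (Finset.sum_congr rfl fun i _ => ?_) ?_
  · rw [← mul_add, ← coef_add, coefVD]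
  · rw [coefVD, Nat.cast_zero, zero_smul, zero_add]

/-- The coefficients of `δ 𝒱`. -/
def coefDeltaV (α β v : ℝ) : ℕ → MatPoly 2
  | 0 => 0
  | 1 => -rC (α + β + 4) • coefV₁ α β v
      + (rC (β - α) - X * rC (α + β + 4)) • coefV₀ α β v
  | 2 => (rC (β - α) - X * rC (α + β + 4) - 2 * X) • coefV₁ α β v
      + (1 - X ^ 2 : ℂ[X]) • coefV₀ α β v
  | 3 => (1 - X ^ 2 : ℂ[X]) • coefV₁ α β v
  | _ => 0

lemma delta_mul_opV : jacobiDelta (α + 1) (β + 1) * opV α β v = diffOp 3 (coefDeltaV α β v) := by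
  have hg : (rC (β + 1 - (α + 1)) - X * rC (α + 1 + (β + 1) + 2) : ℂ[X])
      = rC (β - α) - X * rC (α + β + 4) := by
    rw [show β + 1 - (α + 1) = β - α by ring, show α + 1 + (β + 1) + 2 = α + β + 4 by ring]
  have h : ∀ (k : ℕ) (p : ℂ[X]), del 2 ^ k * coef (p • (1 : MatPoly 2)) * opV α β v
      = del 2 ^ (k + 1) * coef (p • coefV₁ α β v)
        + del 2 ^ k * coef (derivative p • coefV₁ α β v + p • coefV₀ α β v) := by
    intro k p
    rw [opV_eq, mul_add, mul_assoc, ← mul_assoc (coef _) (del 2), coef_mul_del, derivEnd_smul_one,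
      add_mul, mul_assoc, ← coef_mul, ← coef_mul, mul_assoc, ← coef_mul, smul_mul_assoc,
      smul_mul_assoc, smul_mul_assoc, one_mul, one_mul, coef_add, pow_succ]
    simp only [mul_add, mul_assoc]
    abel
  have h1 := h 1 (rC (β - α) - X * rC (α + β + 4))
  rw [pow_one] at h1
  rw [jacobiDelta, hg, add_mul, h, h1, diffOp]
  have hd1 : derivative (1 - X ^ 2 : ℂ[X]) = -(2 * X) := by
    rw [derivative_sub, derivative_one, derivative_X_sq, zero_sub, map_ofNat]
  have hd2 : derivative (rC (β - α) - X * rC (α + β + 4)) = -rC (α + β + 4) := by simp [rC]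
  rw [hd1, hd2]
  simp only [Finset.sum_range_succ, Finset.sum_range_zero, coefDeltaV, coef_zero, mul_zero, zero_add,
    neg_smul, sub_eq_add_neg, Nat.reduceAdd, coef_add, mul_add, pow_one, add_smul]
  abel

/-- Multiplication by `coefN₁` turns `coefV₁` into the nonzero scalar polynomial `1 - x²`. -/
lemma coefV₁_mul_cancel (hv : v ≠ 0) {P Q : MatPoly 2}
    (h : coefV₁ α β v * P = coefV₁ α β v * Q) : P = Q := by
  have h1 := congrArg (fun R => coefN₁ α β v * R) h
  simp only [← mul_assoc, coefN₁_mul_coefV₁ hv, smul_mul_assoc, one_mul] at h1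
  have h2 : (1 - X ^ 2 : ℂ[X]) ≠ 0 := by
    intro h0
    have := congrArg (eval 0) h0
    simp at this
  exact smul_right_injective _ h2 h1

/-- No differential operator has the eigenvalues of `δ` on the orthogonal polynomials for `W`. -/
lemma opV_mul_ne_delta_mul_opV (hv₁ : |α - β| < |v|) (hv₂ : |v| < α + β + 2) {D : RightOp 2}
    (hD : IsDiffOp D) : opV α β v * D ≠ jacobiDelta (α + 1) (β + 1) * opV α β v := by
  have hv := param_ne_zero hv₁
  obtain ⟨m, F₀, rfl⟩ := hD
  -- Padding makes the relations of orders `0` to `3` available even for small `m`.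
  rw [diffOp_extend m (m + 2) F₀ (by omega)]
  set F : ℕ → MatPoly 2 := fun i => if i ≤ m then F₀ i else 0 with hF
  have hF0 : ∀ i, m < i → F i = 0 := fun i hi => if_neg (by omega)
  intro h
  rw [opV_mul_diffOp _ _ (hF0 _ (by omega)), delta_mul_opV, diffOp_extend 3 (m + 2 + 1) _ (by omega)]
    at h
  have hrel := diffOp_injective h
  -- Downward induction: `δ𝒱` has order three, so the relation of order `i + 1 ≥ 4` reduces to
  -- `coefV₁ * F i = 0`.
  have hF3 : ∀ d i, 3 ≤ i → m < i + d → F i = 0 := by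
    intro d
    induction d with
    | zero => exact fun i _ hi => hF0 i hi
    | succ d ih =>
      intro i h3 hi
      by_cases him : m < i
      · exact hF0 i him
      have h1 := hrel (i + 1) (by omega)
      rw [if_neg (by omega), coefVD, ih (i + 1) (by omega) (by omega), mul_zero, add_zero] at h1
      exact coefV₁_mul_cancel hv (h1.trans (mul_zero _).symm)
  have r3 := hrel 3 (by omega)
  have r2 := hrel 2 (by omega)
  have r1 := hrel 1 (by omega)
  have r0 := hrel 0 (by omega)
  rw [if_pos (by omega)] at r0 r1 r2 r3
  simp only [coefVD, coefDeltaV] at r0 r1 r2 r3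
  rw [hF3 m 3 le_rfl (by omega), mul_zero, add_zero] at r3
  have hF2 : F 2 = (1 - X ^ 2 : ℂ[X]) • (1 : MatPoly 2) :=
    coefV₁_mul_cancel hv (by rw [r3, mul_smul_comm, mul_one])
  have hF1 : F 1 = (rC (β - α) - X * rC (α + β + 4) - 2 * X) • (1 : MatPoly 2)
      - (2 : ℂ[X]) • coefN₁ α β v := by
    apply coefV₁_mul_cancel hv
    rw [mul_sub, mul_smul_comm, mul_smul_comm, mul_one, coefV₁_mul_coefN₁ hv]
    rw [hF2, mul_smul_comm, mul_one, smul_add] at r2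
    have h2 : (((1 + 1 : ℕ) : ℂ[X]) • (1 : MatPoly 2)) = (2 : ℂ[X]) • (1 : MatPoly 2) := by
      norm_num
    rw [h2, smul_comm (1 - X ^ 2 : ℂ[X]) (2 : ℂ[X]), ← add_assoc, add_left_inj] at r2
    rw [← r2, add_sub_cancel_right]
  have hk : rC ((v + 2 + α + β) / 2) ≠ 0 := by
    have := param_pos hv₂
    exact C_ne_zero.mpr (Complex.ofReal_ne_zero.mpr (by linarith))
  have hk' : rC ((-v + 2 + α + β) / 2) ≠ 0 := by
    have := param_pos' hv₂
    exact C_ne_zero.mpr (Complex.ofReal_ne_zero.mpr (by linarith))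
  -- In order zero `coefV₀ * F 0 = 0`; the diagonal entries of `coefV₀` are nonzero, so the second
  -- column of `F 0` vanishes.
  have e01 := congrFun (congrFun r0 0) 1
  have e11 := congrFun (congrFun r0 1) 1
  simp only [coefV₀, Matrix.mul_apply, Fin.sum_univ_two, Matrix.of_apply, Matrix.cons_val_zero,
    Matrix.cons_val_one, Matrix.cons_val', Matrix.cons_val_fin_one, zero_mul, add_zero, zero_add,
    Matrix.zero_apply, mul_eq_zero, hk, hk', false_or] at e01 e11
  -- With `F 0` gone from this entry, the order-one relation equates two multiples of `1 + (β-α)/v`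
  -- whose factors differ by `v`, forcing `v(v-α+β) = 0`.
  have e := congrArg (eval 0) (congrFun (congrFun r1 0) 1)
  have e0 : (coefV₁ α β v * F 0) 0 1 = 0 := by
    rw [Matrix.mul_apply, Fin.sum_univ_two, e01, e11, mul_zero, mul_zero, add_zero]
  rw [Matrix.add_apply, e0, zero_add, zero_add, hF1] at e
  have hv' : (v : ℂ) ≠ 0 := by exact_mod_cast hv
  simp [coefV₀, coefV₁, coefN₁, Matrix.mul_apply, rC] at e
  field_simp at e
  have h3 : (v : ℂ) * (v - α + β) = 0 := by linear_combination -e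
  have h4 : v * (v - α + β) = 0 := by exact_mod_cast h3
  exact mul_ne_zero hv (param_sub_add_ne_zero hv₁) h4

end Rigidity

/-! ### The center as `ℂ + quadA · ℂ[t]` -/

section Center

variable {α β v : ℝ}

/-- The operator `𝒩 p(δ) 𝒜 𝒱`. -/
def opNpAV (α β v : ℝ) (p : ℂ[X]) : RightOp 2 :=
  opN α β v * (aeval (jacobiDelta (α + 1) (β + 1)) p * opA α β v) * opV α β v

/-- The quadratic polynomial with `𝒱 𝒩 𝒜 = quadA(δ)`. -/
def quadA (α β v : ℝ) : ℂ[X] := (X - C (cA₁ α β v : ℂ)) * (X - C (cA₂ α β v : ℂ))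

lemma monic_quadA : (quadA α β v).Monic := (monic_X_sub_C _).mul (monic_X_sub_C _)

lemma natDegree_quadA : (quadA α β v).natDegree = 2 := by
  rw [quadA, (monic_X_sub_C _).natDegree_mul (monic_X_sub_C _), natDegree_X_sub_C,
    natDegree_X_sub_C]

lemma isDiffOp_opNpAV (p : ℂ[X]) : IsDiffOp (opNpAV α β v p) :=
  (isDiffOp_opN.mul (((isDiffOp_jacobiDelta _ _).aeval p).mul isDiffOp_opA)).mul isDiffOp_opV

/-- The diagonal eigenvalues of `𝒱𝒩` and `𝒜` have their constants interchanged, so both diagonal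
entries of the product equal `(λ_n - c₁)(λ_n - c₂)`. -/
lemma hasEig_opNpAV (hα : -1 < α) (hv : v ≠ 0) (p : ℂ[X]) (n : ℕ) :
    HasEig (seqQ α β v n) (opNpAV α β v p) ((quadA α β v * p).eval (eigR α β n) • 1) := by
  have h := hasEig_NTV (β := β) hα hv (((isDiffOp_jacobiDelta _ _).aeval p).mul isDiffOp_opA)
    (((hasEig_delta hα n).aeval (isDiffOp_jacobiDelta _ _) p).mul (hasEig_A (v := v) hα n)
      isDiffOp_opA)
  rw [opNpAV]
  convert h using 1
  ext i j
  fin_cases i <;> fin_cases j <;> simp [eigVN, eigA, quadA] <;> ring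

lemma opZ1_eq : opZ1 α β v = opNpAV α β v 1 := by
  rw [opZ1, opNpAV, map_one, one_mul]

lemma opZ2_eq : opZ2 α β v = opNpAV α β v X := by
  rw [opZ2, opNpAV, aeval_X, ← mul_assoc]

lemma hasEig_opZ1 (hα : -1 < α) (hv : v ≠ 0) (n : ℕ) :
    HasEig (seqQ α β v n) (opZ1 α β v) ((quadA α β v).eval (eigR α β n) • 1) := by
  rw [opZ1_eq]
  simpa using hasEig_opNpAV (β := β) hα hv 1 n

lemma isDiffOp_opZ1 : IsDiffOp (opZ1 α β v) := by
  rw [opZ1_eq]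
  exact isDiffOp_opNpAV 1

lemma coef_E₁ : coef (!![1, 0; 0, 0] : MatPoly 2)
    = coef ((!![1, 0; 0, 0] : Matrix (Fin 2) (Fin 2) ℂ).map C) := by
  congr 1
  ext1 i j
  fin_cases i <;> fin_cases j <;> simp

lemma coef_E₄ : coef (!![0, 0; 0, 1] : MatPoly 2)
    = coef ((!![0, 0; 0, 1] : Matrix (Fin 2) (Fin 2) ℂ).map C) := by
  congr 1
  ext1 i j
  fin_cases i <;> fin_cases j <;> simp

lemma hasEig_opD1 (hα : -1 < α) (hv : v ≠ 0) (n : ℕ) :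
    HasEig (seqQ α β v n) (opD1 α β v) !![eigR α β n - cA₂ α β v, 0; 0, 0] := by
  have h := hasEig_NTV (β := β) hα hv (n := n) (isDiffOp_coef _)
    (HasEig.coef_const (jacobiP (α + 1) (β + 1) n) !![1, 0; 0, 0])
  rw [opD1, coef_E₁]
  convert h using 1
  ext i j
  fin_cases i <;> fin_cases j <;> simp [eigVN]

lemma hasEig_opD4 (hα : -1 < α) (hv : v ≠ 0) (n : ℕ) :
    HasEig (seqQ α β v n) (opD4 α β v) !![0, 0; 0, eigR α β n - cA₁ α β v] := by
  have h := hasEig_NTV (β := β) hα hv (n := n) (isDiffOp_coef _)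
    (HasEig.coef_const (jacobiP (α + 1) (β + 1) n) !![0, 0; 0, 1])
  rw [opD4, coef_E₄]
  convert h using 1
  ext i j
  fin_cases i <;> fin_cases j <;> simp [eigVN]

lemma isDiffOp_opD1 : IsDiffOp (opD1 α β v) :=
  (isDiffOp_opN.mul (isDiffOp_coef _)).mul isDiffOp_opV

lemma isDiffOp_opD4 : IsDiffOp (opD4 α β v) :=
  (isDiffOp_opN.mul (isDiffOp_coef _)).mul isDiffOp_opV

lemma opZ1_eq_D1_D4 (hv₁ : |α - β| < |v|) (hv₂ : |v| < α + β + 2) :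
    opZ1 α β v = opD1 α β v ^ 2 + opD4 α β v ^ 2 + (v : ℂ) • (opD1 α β v - opD4 α β v) := by
  have hα := neg_one_lt_left hv₁ hv₂
  have hv := param_ne_zero hv₁
  refine IsDiffOp.ext_of_regular (isRegular_seqQ hv₁ hv₂) isDiffOp_opZ1
    (((isDiffOp_opD1.pow 2).add (isDiffOp_opD4.pow 2)).add
      ((isDiffOp_opD1.sub isDiffOp_opD4).smul _)) fun n => ?_
  have h₁ := hasEig_opD1 (β := β) hα hv n
  have h₄ := hasEig_opD4 (β := β) hα hv n
  have h := ((h₁.pow isDiffOp_opD1 2).add (h₄.pow isDiffOp_opD4 2)).add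
    ((h₁.sub h₄).smul (v : ℂ))
  refine (hasEig_opZ1 hα hv n).eq ?_
  convert h using 1
  -- With `v = c₂ - c₁`, `(t-c₂)² + v(t-c₂)` and `(t-c₁)² - v(t-c₁)` both become `(t-c₁)(t-c₂)`.
  have hc : (v : ℂ) = cA₂ α β v - cA₁ α β v := by rw [← Complex.ofReal_sub, cA₂_sub_cA₁]
  rw [hc]
  ext i j
  fin_cases i <;> fin_cases j <;> simp [quadA, pow_two] <;> ring

lemma opZ2_eq_D1_D4 (hv₁ : |α - β| < |v|) (hv₂ : |v| < α + β + 2) :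
    opZ2 α β v = opD1 α β v ^ 3 + opD4 α β v ^ 3
      + (cA₂ α β v : ℂ) • (opD1 α β v ^ 2 + (v : ℂ) • opD1 α β v)
      + (cA₁ α β v : ℂ) • (opD4 α β v ^ 2 - (v : ℂ) • opD4 α β v)
      + (v : ℂ) • (opD1 α β v ^ 2 - opD4 α β v ^ 2) := by
  have hα := neg_one_lt_left hv₁ hv₂
  have hv := param_ne_zero hv₁
  have d₁ : IsDiffOp (opD1 α β v) := isDiffOp_opD1
  have d₄ : IsDiffOp (opD4 α β v) := isDiffOp_opD4
  rw [opZ2_eq]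
  refine IsDiffOp.ext_of_regular (isRegular_seqQ hv₁ hv₂) (isDiffOp_opNpAV X)
    (((((d₁.pow 3).add (d₄.pow 3)).add (((d₁.pow 2).add (d₁.smul _)).smul _)).add
      (((d₄.pow 2).sub (d₄.smul _)).smul _)).add (((d₁.pow 2).sub (d₄.pow 2)).smul _))
    fun n => ?_
  have h₁ := hasEig_opD1 (β := β) hα hv n
  have h₄ := hasEig_opD4 (β := β) hα hv n
  have h := (((((h₁.pow d₁ 3).add (h₄.pow d₄ 3)).add
    (((h₁.pow d₁ 2).add (h₁.smul (v : ℂ))).smul (cA₂ α β v : ℂ))).add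
      (((h₄.pow d₄ 2).sub (h₄.smul (v : ℂ))).smul (cA₁ α β v : ℂ))).add
        (((h₁.pow d₁ 2).sub (h₄.pow d₄ 2)).smul (v : ℂ)))
  refine (hasEig_opNpAV hα hv X n).eq ?_
  convert h using 1
  have hc : (v : ℂ) = cA₂ α β v - cA₁ α β v := by rw [← Complex.ofReal_sub, cA₂_sub_cA₁]
  rw [hc]
  ext i j
  fin_cases i <;> fin_cases j <;> simp [quadA, pow_succ] <;> ring

lemma isLead_coef_add {N : ℕ} (F G : MatPoly N) : IsLead (del N * coef F + coef G) 1 F := by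
  have h := (isLead_monomial 1 F).add (isLead_monomial 0 G).succ
  simpa using h

lemma isLead_opV (α β v : ℝ) : IsLead (opV α β v) 1 (coefV₁ α β v) := isLead_coef_add _ _

lemma isLead_opN (α β v : ℝ) : IsLead (opN α β v) 1 (coefN₁ α β v) := isLead_coef_add _ _

lemma isLead_delta (a b : ℝ) :
    IsLead (jacobiDelta a b) 2 ((1 - X ^ 2 : ℂ[X]) • (1 : MatPoly 2)) := by
  have h := (isLead_monomial 2 ((1 - X ^ 2 : ℂ[X]) • (1 : MatPoly 2))).add (isLead_monomial 1
    ((rC (b - a) - X * rC (a + b + 2)) • (1 : MatPoly 2))).succ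
  simpa [jacobiDelta] using h

lemma isLead_opA (α β v : ℝ) :
    IsLead (opA α β v) 2 ((1 - X ^ 2 : ℂ[X]) • (1 : MatPoly 2)) := by
  rw [opA_eq, sub_eq_add_neg, ← coef_neg]
  have h := (isLead_delta (α + 1) (β + 1)).add (isLead_monomial 0
    (-((!![(cA₁ α β v : ℂ), 0; 0, (cA₂ α β v : ℂ)] : Matrix (Fin 2) (Fin 2) ℂ).map C))).succ.succ
  simpa using h

lemma one_sub_X_sq_pow_smul_ne_zero (k : ℕ) :
    ((1 - X ^ 2 : ℂ[X]) ^ k) • (1 : MatPoly 2) ≠ 0 := by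
  intro h
  have := congrArg (eval 0) (congrFun (congrFun h 0) 0)
  simp at this

/-- The leading coefficient is `coefN₁ (1-x²) coefV₁ = (1-x²)² I`. -/
lemma hasOrder_opZ1 (hv : v ≠ 0) : HasOrder (opZ1 α β v) 4 := by
  have h := ((isLead_opN α β v).mul (isLead_opA α β v)).mul (isLead_opV α β v)
  refine IsLead.hasOrder h ?_
  rw [mul_smul_comm, mul_one, smul_mul_assoc, coefN₁_mul_coefV₁ hv, smul_smul, ← pow_two]
  exact one_sub_X_sq_pow_smul_ne_zero 2

lemma hasOrder_opZ2 (hv : v ≠ 0) : HasOrder (opZ2 α β v) 6 := by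
  have h := (((isLead_opN α β v).mul (isLead_delta (α + 1) (β + 1))).mul (isLead_opA α β v)).mul
    (isLead_opV α β v)
  refine IsLead.hasOrder h ?_
  rw [mul_smul_comm, mul_one, mul_smul_comm, mul_one, smul_mul_assoc, smul_mul_assoc,
    coefN₁_mul_coefV₁ hv, smul_smul, smul_smul, ← pow_two, ← pow_succ]
  exact one_sub_X_sq_pow_smul_ne_zero 3

/-- Every polynomial is a multiple of `quadA` up to a polynomial of degree at most one. -/
lemma exists_quadA_div (p : ℂ[X]) :
    ∃ a b : ℂ, p = quadA α β v * (p /ₘ quadA α β v) + (C a + C b * X) := by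
  have h := modByMonic_add_div p (quadA α β v)
  have hd : (p %ₘ quadA α β v).natDegree ≤ 1 := by
    have := natDegree_modByMonic_lt p monic_quadA (by
      intro h1
      have := natDegree_quadA (α := α) (β := β) (v := v)
      rw [h1] at this
      simp at this)
    rw [natDegree_quadA] at this
    omega
  obtain ⟨b, a, hab⟩ := exists_eq_X_add_C_of_natDegree_le_one hd
  exact ⟨a, b, by rw [← add_comm (C b * X), ← hab, add_comm, h]⟩

/-- Divide the eigenvalue polynomial by `quadA`: the quotient gives `p`, the constant remainder
gives `c`, and rigidity excludes a linear remainder. -/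
lemma mem_centerD_jacobiW_iff_opNpAV (hv₁ : |α - β| < |v|) (hv₂ : |v| < α + β + 2)
    (D : RightOp 2) : D ∈ centerD (Set.Ioo (-1) 1) (jacobiW α β v)
      ↔ ∃ (c : ℂ) (p : ℂ[X]), c • 1 + opNpAV α β v p = D := by
  have hα := neg_one_lt_left hv₁ hv₂
  have hβ := neg_one_lt_right hv₁ hv₂
  have hv := param_ne_zero hv₁
  rw [mem_centerD_jacobiW_iff hv₁ hv₂]
  constructor
  · rintro ⟨hD, h⟩
    obtain ⟨l, hl⟩ := exists_poly_eigenvalue hα hv₂ hD h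
    obtain ⟨a, b, hab⟩ := exists_quadA_div (α := α) (β := β) (v := v) l
    set p := l /ₘ quadA α β v
    set E := a • 1 + opNpAV α β v p with hE
    have hEd : IsDiffOp E := (IsDiffOp.one.smul a).add (isDiffOp_opNpAV p)
    have hEe : ∀ n, HasEig (seqQ α β v n) (D - E) ((b * eigR α β n) • 1) := by
      intro n
      have h1 := (hasEig_smul_one_iff.mpr (hl n)).sub
        (((HasEig.one _).smul a).add (hasEig_opNpAV (β := β) hα hv p n))
      convert h1 using 1
      rw [← add_smul, ← sub_smul]
      congr 1
      conv_rhs => rw [hab]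
      simp only [eval_add, eval_mul, eval_C, eval_X]
      ring
    -- Otherwise `b⁻¹(D - E)` acts on `Q_n = R_n · 𝒱` by `λ_n`, which amounts to `𝒱 b⁻¹(D - E) =
    -- δ𝒱`.
    have hb : b = 0 := by
      by_contra hb
      refine opV_mul_ne_delta_mul_opV hv₁ hv₂ ((hD.sub hEd).smul b⁻¹)
        (IsDiffOp.ext_of_regular (isRegular_seqR hα hβ)
          (isDiffOp_opV.mul ((hD.sub hEd).smul b⁻¹))
          ((isDiffOp_jacobiDelta _ _).mul isDiffOp_opV) fun n => ?_)
      have h1 := hasEig_smul_one_iff.mp ((hEe n).smul b⁻¹ |> fun h => by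
        rwa [smul_smul, inv_mul_cancel_left₀ hb] at h)
      rw [act_mul, act_mul, hasEig_smul_one_iff.mp (hasEig_delta hα n), smul_act]
      exact h1
    refine ⟨a, p, ?_⟩
    refine IsDiffOp.ext_of_regular (isRegular_seqQ hv₁ hv₂) hEd hD fun n => ?_
    have h1 := hasEig_smul_one_iff.mp (hEe n)
    rw [hb, zero_mul, zero_smul, act_sub, sub_eq_zero] at h1
    exact h1.symm
  · rintro ⟨c, p, rfl⟩
    refine ⟨(IsDiffOp.one.smul c).add (isDiffOp_opNpAV p), fun n =>
      ⟨c + (quadA α β v * p).eval (eigR α β n), ?_⟩⟩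
    rw [← hasEig_smul_one_iff, add_smul]
    exact ((HasEig.one _).smul c).add (hasEig_opNpAV hα hv p n)

/-- If `p = quadA q + a + b t`, then `quadA p = quadA (quadA q) + a quadA + b t quadA`, where the
last two terms are multiples of the eigenvalues of `Z₁` and `Z₂`; induct on the degree. -/
lemma opNpAV_mem_adjoin (hv₁ : |α - β| < |v|) (hv₂ : |v| < α + β + 2) (p : ℂ[X]) :
    opNpAV α β v p ∈ Algebra.adjoin ℂ {1, opZ1 α β v, opZ2 α β v} := by
  have hα := neg_one_lt_left hv₁ hv₂
  have hv := param_ne_zero hv₁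
  have m₁ : opZ1 α β v ∈ Algebra.adjoin ℂ {1, opZ1 α β v, opZ2 α β v} :=
    Algebra.subset_adjoin (by simp)
  have m₂ : opZ2 α β v ∈ Algebra.adjoin ℂ {1, opZ1 α β v, opZ2 α β v} :=
    Algebra.subset_adjoin (by simp)
  induction hn : p.natDegree using Nat.strong_induction_on generalizing p with
  | _ n ih =>
    obtain ⟨a, b, hab⟩ := exists_quadA_div (α := α) (β := β) (v := v) p
    set q := p /ₘ quadA α β v with hq
    have hdec : opNpAV α β v p = opZ1 α β v * opNpAV α β v q + a • opZ1 α β v + b • opZ2 α β v := by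
      refine IsDiffOp.ext_of_regular (isRegular_seqQ hv₁ hv₂) (isDiffOp_opNpAV p)
        (((isDiffOp_opZ1.mul (isDiffOp_opNpAV q)).add (isDiffOp_opZ1.smul a)).add
          (IsDiffOp.smul (by rw [opZ2_eq]; exact isDiffOp_opNpAV X) b)) fun n => ?_
      refine (hasEig_opNpAV hα hv p n).eq ?_
      have h := (((hasEig_opZ1 (β := β) hα hv n).mul (hasEig_opNpAV hα hv q n)
        (isDiffOp_opNpAV q)).add ((hasEig_opZ1 (β := β) hα hv n).smul a)).add
          ((hasEig_opNpAV (β := β) hα hv X n).smul b)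
      rw [opZ2_eq]
      convert h using 1
      rw [smul_mul_smul_comm, one_mul, smul_smul, smul_smul, ← add_smul, ← add_smul]
      congr 1
      conv_lhs => rw [hab]
      simp only [eval_add, eval_mul, eval_C, eval_X]
      ring
    have hqm : opNpAV α β v q ∈ Algebra.adjoin ℂ {1, opZ1 α β v, opZ2 α β v} := by
      by_cases h0 : p.natDegree < 2
      · have : q = 0 := by
          rw [hq, divByMonic_eq_zero_iff monic_quadA]
          exact degree_lt_degree (by rwa [natDegree_quadA])
        rw [this, opNpAV, map_zero, zero_mul, mul_zero, zero_mul]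
        exact zero_mem _
      · refine ih q.natDegree ?_ q rfl
        rw [hq, natDegree_divByMonic _ monic_quadA, natDegree_quadA]
        omega
    rw [hdec]
    exact add_mem (add_mem (mul_mem m₁ hqm) (Subalgebra.smul_mem _ m₁ a))
      (Subalgebra.smul_mem _ m₂ b)

lemma centerD_jacobiW_eq_adjoin (hv₁ : |α - β| < |v|) (hv₂ : |v| < α + β + 2) :
    centerD (Set.Ioo (-1) 1) (jacobiW α β v)
      = Algebra.adjoin ℂ {1, opZ1 α β v, opZ2 α β v} := by
  apply le_antisymm
  · intro D hD
    obtain ⟨c, p, rfl⟩ := (mem_centerD_jacobiW_iff_opNpAV hv₁ hv₂ D).mp hD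
    exact add_mem (Subalgebra.smul_mem _ (one_mem _) c) (opNpAV_mem_adjoin hv₁ hv₂ p)
  · refine Algebra.adjoin_le ?_
    rintro D (rfl | rfl | rfl)
    · exact one_mem _
    · exact (mem_centerD_jacobiW_iff_opNpAV hv₁ hv₂ _).mpr
        ⟨0, 1, by rw [zero_smul, zero_add, opZ1_eq]⟩
    · exact (mem_centerD_jacobiW_iff_opNpAV hv₁ hv₂ _).mpr
        ⟨0, X, by rw [zero_smul, zero_add, opZ2_eq]⟩

lemma mem_map_mulLeftRight_iff (hα : -1 < α) (hβ : -1 < β) (D : RightOp 2) :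
    D ∈ (Subalgebra.toSubmodule (centerD (Set.Ioo (-1) 1) (jacobiWt α β))).map
        (LinearMap.mulLeftRight ℂ (opN α β v, opA α β v * opV α β v))
      ↔ ∃ p, opNpAV α β v p = D := by
  simp only [Submodule.mem_map, Subalgebra.mem_toSubmodule, LinearMap.mulLeftRight_apply,
    mem_centerD_jacobiWt_iff_aeval hα hβ, opNpAV]
  constructor
  · rintro ⟨_, ⟨p, rfl⟩, rfl⟩
    exact ⟨p, by simp only [mul_assoc]⟩
  · rintro ⟨p, rfl⟩
    exact ⟨_, ⟨p, rfl⟩, by simp only [mul_assoc]⟩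

lemma centerD_jacobiW_eq_sup (hv₁ : |α - β| < |v|) (hv₂ : |v| < α + β + 2) :
    Subalgebra.toSubmodule (centerD (Set.Ioo (-1) 1) (jacobiW α β v))
      = Submodule.span ℂ {(1 : RightOp 2)} ⊔
        (Subalgebra.toSubmodule (centerD (Set.Ioo (-1) 1) (jacobiWt α β))).map
          (LinearMap.mulLeftRight ℂ (opN α β v, opA α β v * opV α β v)) := by
  ext D
  rw [Subalgebra.mem_toSubmodule, mem_centerD_jacobiW_iff_opNpAV hv₁ hv₂, Submodule.mem_sup]
  simp only [mem_map_mulLeftRight_iff (neg_one_lt_left hv₁ hv₂) (neg_one_lt_right hv₁ hv₂),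
    Submodule.mem_span_singleton]
  constructor
  · rintro ⟨c, p, rfl⟩
    exact ⟨_, ⟨c, rfl⟩, _, ⟨p, rfl⟩, rfl⟩
  · rintro ⟨_, ⟨c, rfl⟩, _, ⟨p, rfl⟩, rfl⟩
    exact ⟨c, p, rfl⟩

/-- In the intersection `quadA p` takes one value `c` at the infinitely many `λ_n`, hence is
constant; evaluation at the root `c₁` gives `c = 0`. -/
lemma disjoint_span_one_map (hv₁ : |α - β| < |v|) (hv₂ : |v| < α + β + 2) :
    Disjoint (Submodule.span ℂ {(1 : RightOp 2)})
      ((Subalgebra.toSubmodule (centerD (Set.Ioo (-1) 1) (jacobiWt α β))).map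
        (LinearMap.mulLeftRight ℂ (opN α β v, opA α β v * opV α β v))) := by
  have hα := neg_one_lt_left hv₁ hv₂
  have hβ := neg_one_lt_right hv₁ hv₂
  rw [Submodule.disjoint_def]
  intro D h₁ h₂
  rw [mem_map_mulLeftRight_iff hα hβ] at h₂
  obtain ⟨p, rfl⟩ := h₂
  obtain ⟨c, hc⟩ := Submodule.mem_span_singleton.mp h₁
  have hev : ∀ n, (quadA α β v * p).eval (eigR α β n) = c := by
    intro n
    have h1 := hasEig_opNpAV (β := β) hα (param_ne_zero hv₁) p n
    have h2 := (HasEig.one (seqQ α β v n)).smul c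
    rw [hc] at h2
    have h3 := (isRegular_seqQ hv₁ hv₂ n).const_mul_cancel (h1.symm.trans h2)
    simpa using congrFun (congrFun h3 0) 0
  have hpoly : quadA α β v * p = C c := by
    refine Polynomial.eq_of_infinite_eval_eq _ _ (Set.Infinite.mono ?_
      (Set.infinite_range_of_injective
        (jacobiEig_injective (a := α + 1) (b := β + 1) (by linarith) (by linarith))))
    rintro _ ⟨n, rfl⟩
    have := hev n
    simpa [eigR] using this
  have h0 := congrArg (eval (cA₁ α β v : ℂ)) hpoly
  rw [quadA, eval_mul, eval_mul, eval_sub, eval_X, eval_C, sub_self, zero_mul, zero_mul,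
    eval_C] at h0
  rw [← hc, ← h0, zero_smul]

end Center

end MatOP

end

theorem mainTheorem10 (α β v : ℝ) (hv₁ : |α - β| < |v|) (hv₂ : |v| < α + β + 2) :
    -- `Z₁` and `Z₂` have orders four and six, and their expressions through `D₁` and `D₄`
    MatOP.HasOrder (MatOP.opZ1 α β v) 4 ∧
    MatOP.HasOrder (MatOP.opZ2 α β v) 6 ∧
    MatOP.opZ1 α β v =
      MatOP.opD1 α β v ^ 2 + MatOP.opD4 α β v ^ 2
        + (v : ℂ) • (MatOP.opD1 α β v - MatOP.opD4 α β v) ∧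
    MatOP.opZ2 α β v =
      MatOP.opD1 α β v ^ 3 + MatOP.opD4 α β v ^ 3
        + ((1 / 4 * (-v + 4 + α + β) * (v + 2 + α + β) : ℝ) : ℂ) •
            (MatOP.opD1 α β v ^ 2 + (v : ℂ) • MatOP.opD1 α β v)
        + ((1 / 4 * (-v + 2 + α + β) * (v + 4 + α + β) : ℝ) : ℂ) •
            (MatOP.opD4 α β v ^ 2 - (v : ℂ) • MatOP.opD4 α β v)
        + (v : ℂ) • (MatOP.opD1 α β v ^ 2 - MatOP.opD4 α β v ^ 2) ∧
    -- the center is generated by `I`, `Z₁`, `Z₂`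
    MatOP.centerD (Set.Ioo (-1) 1) (MatOP.jacobiW α β v) =
      Algebra.adjoin ℂ {1, MatOP.opZ1 α β v, MatOP.opZ2 α β v} ∧
    -- the center is the direct sum of `ℂ I` and `𝒩 𝒵(W̃) 𝒜 𝒱`
    Subalgebra.toSubmodule (MatOP.centerD (Set.Ioo (-1) 1) (MatOP.jacobiW α β v)) =
      Submodule.span ℂ {(1 : MatOP.RightOp 2)} ⊔
        (Subalgebra.toSubmodule
          (MatOP.centerD (Set.Ioo (-1) 1) (MatOP.jacobiWt α β))).map
          (LinearMap.mulLeftRight ℂ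
            (MatOP.opN α β v, MatOP.opA α β v * MatOP.opV α β v)) ∧
    Disjoint (Submodule.span ℂ {(1 : MatOP.RightOp 2)})
      ((Subalgebra.toSubmodule
          (MatOP.centerD (Set.Ioo (-1) 1) (MatOP.jacobiWt α β))).map
          (LinearMap.mulLeftRight ℂ
            (MatOP.opN α β v, MatOP.opA α β v * MatOP.opV α β v))) :=
  ⟨MatOP.hasOrder_opZ1 (MatOP.param_ne_zero hv₁), MatOP.hasOrder_opZ2 (MatOP.param_ne_zero hv₁),
    MatOP.opZ1_eq_D1_D4 hv₁ hv₂, by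
      have h := MatOP.opZ2_eq_D1_D4 hv₁ hv₂
      rwa [show MatOP.cA₁ α β v = 1 / 4 * (-v + 2 + α + β) * (v + 4 + α + β) by
        rw [MatOP.cA₁]; ring, MatOP.cA₂] at h,
    MatOP.centerD_jacobiW_eq_adjoin hv₁ hv₂, MatOP.centerD_jacobiW_eq_sup hv₁ hv₂,
    MatOP.disjoint_span_one_map hv₁ hv₂⟩
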